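/- **Setting.** Let $\Omega=\{x\in\mathbb R^3:x_3>0\}$, $\partial\Omega=\{x_3=0\}$, and let $D,\mu_A,c_f>0$, $\beta\ge 0$ be constants. With $\operatorname{erfc}(\xi)=\frac{2}{\sqrt\pi}\int_\xi^\infty e^{-s^2}ds$ put, for $t>0$, $x_s\in\partial\Omega$, $$u_e(x,t;x_s)=\frac{De^{-\mu_At}}{(4\pi Dt)^{3/2}}e^{-\frac{(x_1-x_{s1})^2+(x_2-x_{s2})^2}{4Dt}}\Big(2e^{-\frac{x_3^2}{4Dt}}-2\beta\sqrt{\pi Dt}\,e^{\beta x_3+\beta^2Dt}\operatorname{erfc}\Big(\tfrac{x_3+2\beta Dt}{\sqrt{4Dt}}\Big)\Big),$$ $$K(x,y;t)=\frac{e^{-\mu_At}}{(4\pi Dt)^{3/2}}e^{-\frac{(x_1-y_1)^2+(x_2-y_2)^2}{4Dt}}\Big(e^{-\frac{(x_3+y_3)^2}{4Dt}}+e^{-\frac{(x_3-y_3)^2}{4Dt}}-2\beta\sqrt{\pi Dt}\,e^{\beta(x_3+y_3)+\beta^2Dt}\operatorname{erfc}\Big(\tfrac{x_3+y_3+2\beta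 Dt}{\sqrt{4Dt}}\Big)\Big)$$ (the excitation light, and the Green function of $\partial_t-D\Delta+\mu_A$ in $\Omega$ with Robin condition $-\partial_3K+\beta K=0$ on $\partial\Omega$). Let $\mathcal A$ be the set of $\mathbf a=(a_1,b_1,a_2,b_2,a_3,b_3,P)\in\mathbb R^7$ with $a_1<b_1$, $a_2<b_2$, $0<a_3<b_3$, $P>0$, and for $\mathbf a\in\mathcal A$ let $\mu_f$ be equal to $P$ on the cuboid $\prod_{i=1}^3(a_i,b_i)$ and $0$ elsewhere. For $\tau\ge0$ let $f(x,t;\tau)=c_f\frac{\mu_f(x)}{\tau}\int_0^te^{-(t-s)/\tau}u_e(x,s;x_s)\,ds$ if $\tau>0$, $f(x,t;0)=c_f\mu_f(x)u_e(x,t;x_s)$, and let $$v_\tau(\mathbf a)(x,t;x_s)=\int_0^t\int_\Omega K(x,y;t-s)f(y,s;\tau)\,dy\,ds$$ be the emission light with lifetime $\tau$. The measured quantity $u_m(\mathbf a)(t,\omega)$, for $t>0$ and a source–detector pair $\omega=(x_d,x_s)\in\partial\Omega\times\partial\Omega$, is either the zero-lifetime emission light $v_0(\mathbf a)(x_d,t;x_s)$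 or the detected emission light $\int_0^tq(s)\,v_\tau(\mathbf a)(x_d,t-s;x_s)\,ds$, where $\tau\ge 0$ and the instrumental response function $q$ is locally integrable on $[0,\infty)$ and real analytic on $(0,\infty)$. Fix $d=7$ pairs $\hat\omega=(\omega_1,\dots,\omega_7)$ and an interval $\mathcal T\subset(0,\infty)$, and let $$\tilde F(t)(\mathbf a)=\det\nabla_{\mathbf a}\big(u_m(\mathbf a)(t,\omega_1),\dots,u_m(\mathbf a)(t,\omega_7)\big).$$ The determinant condition holds in $\mathcal A'\subset\mathcal A$ at time $t$ if $\tilde F(t)(\mathbf a)\ne0$ for all $\mathbf a\in\mathcal A'$. The set $\{t_1,\dots,t_7\}\times\{\omega_1,\dots,\omega_7\}$ is $F$-complete in $\mathcal A'$ if $\mathcal A'$ is a finite union of relatively open subsets $\mathcal A'_p$ such that for each $p$ there is a $k$ with $|\tilde F(t_k)(\mathbf a)|>0$ for all $\mathbf a\in\mathcal A'_p$. Let $S(\mathcal A')\subset\mathcal T^7$ be the set of $(t_1,\dots,t_7)$ for which this holds. **Theorem.** Let $\mathcal B=B_r(\mathbf a_0)\subset\mathcal A$, $r>0$, be an open ball,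 and suppose that the determinant condition holds in $\mathcal B$ at one time $t_*\in\mathcal T$. Then: 1. $S(\mathcal B)$ is dense in $\mathcal T^7$. 2. For every compact $C\subset\mathcal B$, the set $S(C)$ is open and dense in $\mathcal T^7$. 3. If moreover the closed ball $\overline{\mathcal B}$ is contained in $\mathcal A$ and the determinant condition holds in $\overline{\mathcal B}$ at $t_*$, then $S(\overline{\mathcal B})$ is open and dense in $\mathcal T^7$. -/

import Mathlib

open MeasureTheory

noncomputable section

namespace FDOT

/-- The constants of the diffusion model in the half space: diffusion coefficient `D`, absorption
rate `μA`, Robin coefficient `β`, and the positive factor `cf` in the fluorescence source. -/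
structure Medium where
  D : ℝ
  μA : ℝ
  β : ℝ
  cf : ℝ
  D_pos : 0 < D
  μA_pos : 0 < μA
  β_nonneg : 0 ≤ β
  cf_pos : 0 < cf

/-- Points of three-dimensional space; the coordinates `x₁, x₂, x₃` are `x 0, x 1, x 2`. -/
abbrev Point := Fin 3 → ℝ

/-- The half space `Ω`. -/
def halfSpace : Set Point := {x | 0 < x 2}

/-- The boundary `∂Ω` of the half space. -/
def boundary : Set Point := {x | x 2 = 0}

/-- A source-detector pair `ω = (x_d, x_s)`: first the detector, then the source. -/
abbrev SDPair := boundary × boundary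

/-- The complementary error function. -/
def erfc (ξ : ℝ) : ℝ := 2 / √Real.pi * ∫ s in Set.Ioi ξ, Real.exp (-s ^ 2)

/-- The third-coordinate factor `K₃(x₃, y₃; t)` of the Green function. -/
def K3 (m : Medium) (x y t : ℝ) : ℝ :=
  Real.exp (-(x + y) ^ 2 / (4 * m.D * t)) + Real.exp (-(x - y) ^ 2 / (4 * m.D * t))
    - 2 * m.β * √(Real.pi * m.D * t) * Real.exp (m.β * (x + y) + m.β ^ 2 * m.D * t)
      * erfc ((x + y + 2 * m.β * m.D * t) / √(4 * m.D * t))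

/-- The Green function `K(x, y; t)`, `t > 0`, of `∂ₜ - DΔ + μ_A` in the half space with the Robin
boundary condition `-∂₃K + βK = 0`. -/
def greenK (m : Medium) (x y : Point) (t : ℝ) : ℝ :=
  Real.exp (-m.μA * t) / (4 * Real.pi * m.D * t) ^ (3 / 2 : ℝ)
    * Real.exp (-((x 0 - y 0) ^ 2 + (x 1 - y 1) ^ 2) / (4 * m.D * t)) * K3 m (x 2) (y 2) t

/-- The excitation light `u_e(x, t; x_s)`. -/
def excitation (m : Medium) (x : Point) (t : ℝ) (xs : Point) : ℝ :=
  m.D * Real.exp (-m.μA * t) / (4 * Real.pi * m.D * t) ^ (3 / 2 : ℝ)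
    * Real.exp (-((x 0 - xs 0) ^ 2 + (x 1 - xs 1) ^ 2) / (4 * m.D * t))
    * (2 * Real.exp (-(x 2) ^ 2 / (4 * m.D * t))
      - 2 * m.β * √(Real.pi * m.D * t) * Real.exp (m.β * x 2 + m.β ^ 2 * m.D * t)
        * erfc ((x 2 + 2 * m.β * m.D * t) / √(4 * m.D * t)))

/-- The parameter space. The coordinates `0, …, 6` of the parameter vector are
`a₁, b₁, a₂, b₂, a₃, b₃, P`. -/
abbrev Param := EuclideanSpace ℝ (Fin 7)

/-- The parameters of a cuboid target with `a₁ < b₁`, `a₂ < b₂`, `0 < a₃ < b₃` and absorption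
coefficient `P > 0`. -/
def admissible : Set Param :=
  {a | a 0 < a 1 ∧ a 2 < a 3 ∧ 0 < a 4 ∧ a 4 < a 5 ∧ 0 < a 6}

/-- The cuboid with parameters `a`. -/
def cuboid (a : Param) : Set Point :=
  {x | x ∈ halfSpace ∧ x 0 ∈ Set.Ioo (a 0) (a 1) ∧ x 1 ∈ Set.Ioo (a 2) (a 3)
    ∧ x 2 ∈ Set.Ioo (a 4) (a 5)}

/-- The absorption coefficient `μ_f` of the fluorophore: `P` in the cuboid and `0` elsewhere. -/
def muF (a : Param) : Point → ℝ := (cuboid a).indicator fun _ => a 6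

/-- The source term `f(x, t; τ)` of the emission light. For lifetime `τ = 0` it is the limit
`c_f μ_f u_e` of the expression for `τ > 0`. -/
def source (m : Medium) (τ : ℝ) (a : Param) (xs x : Point) (t : ℝ) : ℝ :=
  if τ = 0 then m.cf * muF a x * excitation m x t xs
  else m.cf * (muF a x / τ) * ∫ s in (0 : ℝ)..t, Real.exp (-(t - s) / τ) * excitation m x s xs

/-- The emission light with lifetime `τ`: the solution of the diffusion equation with source
`f(·, ·; τ)`, zero initial value and homogeneous Robin condition, given by the Green function. -/
def emission (m : Medium) (τ : ℝ) (a : Param) (x : Point) (t : ℝ) (xs : Point) : ℝ :=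
  ∫ s in (0 : ℝ)..t, ∫ y in halfSpace, greenK m x y (t - s) * source m τ a xs y s

/-- An instrumental response function: locally integrable on `[0, ∞)` and real analytic on
`(0, ∞)`. -/
structure Response where
  q : ℝ → ℝ
  integrable : ∀ t : ℝ, 0 < t → IntervalIntegrable q volume 0 t
  analytic : AnalyticOnNhd ℝ q (Set.Ioi 0)

/-- The two kinds of measured quantity: the zero-lifetime emission light itself, or the emission
light with lifetime `τ ≥ 0` detected through an instrumental response function. -/
inductive Measurement where
  | zeroLifetime : Measurement
  | detected (q : Response) (τ : ℝ) (hτ : 0 ≤ τ) : Measurement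

/-- The measured quantity `u_m(a)(t, ω)`. -/
def measured (m : Medium) : Measurement → Param → ℝ → SDPair → ℝ
  | .zeroLifetime, a, t, ω => emission m 0 a ω.1 t ω.2
  | .detected q τ _, a, t, ω => ∫ s in (0 : ℝ)..t, q.q s * emission m τ a ω.1 (t - s) ω.2

/-- The determinant `F̃(t, ω̂)(a)` of the Jacobian matrix, with respect to `a`, of
`M(t, ω̂)(a) = (u_m(a)(t, ω₁), …, u_m(a)(t, ω₇))`. -/
def detF (m : Medium) (u : Measurement) (ω : Fin 7 → SDPair) (t : ℝ) (a : Param) : ℝ :=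
  (Matrix.of fun i j : Fin 7 =>
    fderiv ℝ (fun b : Param => measured m u b t (ω i)) a (EuclideanSpace.single j 1)).det

/-- The determinant condition at time `t` in the set `A`. -/
def DetCondition (m : Medium) (u : Measurement) (ω : Fin 7 → SDPair) (t : ℝ) (A : Set Param) :
    Prop :=
  ∀ a ∈ A, detF m u ω t a ≠ 0

/-- `{t₁, …, t_K} × {ω₁, …, ω₇}` is `F`-complete in `A`: there is a finite cover of `A` by
(relatively) open subsets on each of which `|F̃(t_k, ω̂)| > 0` for some `k`. -/
def FComplete (m : Medium) (u : Measurement) (ω : Fin 7 → SDPair) {K : ℕ} (t : Fin K → ℝ)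
    (A : Set Param) : Prop :=
  ∃ (n : ℕ) (C : Fin n → Set Param),
    (∀ p, ∃ U : Set Param, IsOpen U ∧ C p = A ∩ U) ∧ A = ⋃ p, C p ∧
      ∀ p, ∃ k, ∀ a ∈ C p, 0 < |detF m u ω (t k) a|

/-- The 7-tuples of times in `T` that are `F`-complete in `A`, as a subset of `T⁷` (with the
subspace topology). -/
def completeTimes (m : Medium) (u : Measurement) (ω : Fin 7 → SDPair) (T : Set ℝ)
    (A : Set Param) : Set (Fin 7 → T) :=
  {t | FComplete m u ω (fun k => (t k : ℝ)) A}

end FDOT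

end

/-! The determinant at time `t` factors as `P ^ 6` times `G (L p, t)`. Here `p` collects the six
edge coordinates, `L p` is a 7-tuple of continuous functionals on a fixed Banach space
(`edgeFunctional`), and `G` (`boxDet`) is jointly analytic in the functionals and in `t > 0`
(`analyticOnNhd_boxDet`). The map `p ↦ L p` is only needed to be Lipschitz in operator norm
(`exists_lipschitzOnWith_edgeFunctional`).

Since `G (L p, ·)` is analytic and nonzero at `t_*`, it has no zero of infinite order. Sort the
zeros by the first time derivative that does not vanish: where the `j`-th derivative is zero and the
next one is not, the mean value theorem in `t` and the Lipschitz bound in `p` make the zero time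
locally a Lipschitz function of `p`. The zero set is therefore a countable union of Lipschitz graphs
over a six-dimensional space (`isCountablyLipschitzGraph_zeros`). A bad 7-tuple consists of seven
zeros at one common `p`, so the bad tuples form a countable union of Lipschitz images of subsets of
a six-dimensional space. Their Hausdorff dimension is at most 6, and the complement is dense in
seven dimensions (`dense_setOf_forall_exists_notMem`). Openness over compact sets follows from joint
continuity of the determinant (`continuousAt_detF`).

The Banach space must make the time kernel analytic and `L` Lipschitz simultaneously. The
derivatives in the edges are integrals over faces, and on `C(K)` such functionals do not depend
norm-continuously on the position of the face. The space `Jet` therefore carries a function together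
with candidate partial derivatives, and a value on a face is rewritten as a value on the box
boundary plus an integral of a derivative; its dependence on the face is Lipschitz
(`norm_recover_sub_le`). The rewriting is legitimate for jets satisfying the fundamental theorem of
calculus (`defect`), a property that passes to Leibniz products and time convolutions.

Analyticity of the kernel comes from that of the excitation light as a `C(K)`-valued function of
time, with bounds near `t = 0` because the box stays away from the boundary, and from stability of
analyticity under convolution (`timeConv_analytic`). -/

/-! ### Analytic functions acting pointwise on spaces of continuous functions. -/

section Superposition

variable {I F G : Type*} [TopologicalSpace I] [CompactSpace I]
  [NormedAddCommGroup F] [NormedSpace ℝ F] [NormedAddCommGroup G] [NormedSpace ℝ G]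

/-- The continuous multilinear map on `C(I, F)` which applies `q` pointwise. -/
noncomputable def ContinuousMultilinearMap.pointwise (I : Type*) [TopologicalSpace I]
    [CompactSpace I] {n : ℕ} (q : ContinuousMultilinearMap ℝ (fun _ : Fin n => F) G) :
    ContinuousMultilinearMap ℝ (fun _ : Fin n => C(I, F)) C(I, G) :=
  MultilinearMap.mkContinuous
    { toFun := fun m => ⟨fun s => q fun i => m i s,
        q.cont.comp (continuous_pi fun i => (m i).continuous)⟩
      map_update_add' := by
        intro _ m i x y
        ext s
        have h : ∀ z : C(I, F), (fun j => (Function.update m i z) j s)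
            = Function.update (fun j => m j s) i (z s) := by
          intro z; ext j
          by_cases hj : j = i
          · subst hj; simp
          · simp [hj]
        convert q.map_update_add (fun j => m j s) i (x s) (y s) using 1
        · simp [h]
        · simp [h]
      map_update_smul' := by
        intro _ m i c x
        ext s
        have h : ∀ z : C(I, F), (fun j => (Function.update m i z) j s)
            = Function.update (fun j => m j s) i (z s) := by
          intro z; ext j
          by_cases hj : j = i
          · subst hj; simp
          · simp [hj]
        convert q.map_update_smul (fun j => m j s) i c (x s) using 1
        · simp [h]
        · simp [h] }
    ‖q‖ (by
      intro m
      refine (ContinuousMap.norm_le _ (by positivity)).2 fun s => ?_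
      refine (q.le_opNorm _).trans ?_
      gcongr with i
      exact (m i).norm_coe_le_norm s)

theorem ContinuousMultilinearMap.norm_pointwise_le {n : ℕ}
    (q : ContinuousMultilinearMap ℝ (fun _ : Fin n => F) G) : ‖q.pointwise I‖ ≤ ‖q‖ :=
  MultilinearMap.mkContinuous_norm_le _ (norm_nonneg _) _

/-- A function with a power series acts analytically on continuous functions with values in the
ball of convergence. -/
theorem HasFPowerSeriesOnBall.exists_superposition [CompleteSpace G] {φ : F → G}
    {p : FormalMultilinearSeries ℝ F G} {x₀ : F} {r : ENNReal}
    (h : HasFPowerSeriesOnBall φ p x₀ r) :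
    ∃ Ψ : C(I, F) → C(I, G), ∀ f : C(I, F), f ∈ Metric.eball (0 : C(I, F)) r →
      AnalyticAt ℝ Ψ f ∧ ∀ s, Ψ f s = φ (x₀ + f s) := by
  -- Acting pointwise does not increase the norms of the coefficients, so this series converges at
  -- least where `p` does; evaluation at `s` is continuous linear and identifies its sum.
  let P : FormalMultilinearSeries ℝ C(I, F) C(I, G) := fun n => (p n).pointwise I
  have hrad : p.radius ≤ P.radius := by
    refine ENNReal.le_of_forall_nnreal_lt fun ρ hρ => ?_
    obtain ⟨C, -, hC⟩ := p.norm_mul_pow_le_of_lt_radius hρ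
    refine P.le_radius_of_bound C fun n => le_trans ?_ (hC n)
    gcongr
    exact (p n).norm_pointwise_le
  have hr : r ≤ P.radius := h.r_le.trans hrad
  refine ⟨P.sum, fun f hf => ⟨?_, fun s => ?_⟩⟩
  · exact (P.hasFPowerSeriesOnBall (h.r_pos.trans_le hr)).analyticAt_of_mem
      (Metric.eball_subset_eball hr hf)
  · have h1 := P.hasSum (Metric.eball_subset_eball hr hf)
    have h2 := (ContinuousMap.evalCLM ℝ s : C(I, G) →L[ℝ] G).hasSum h1
    have h3 : f s ∈ Metric.eball (0 : F) r := by
      simp only [Metric.mem_eball, edist_zero_right] at hf ⊢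
      refine lt_of_le_of_lt ?_ hf
      rw [enorm_eq_nnnorm, enorm_eq_nnnorm]
      exact_mod_cast f.norm_coe_le_norm s
    exact h2.unique (h.hasSum h3)

end Superposition

/-! ### Analytic dependence of weighted integrals on a parameter. -/

section ParametricIntegral

variable {X Y Z : Type*} [NormedAddCommGroup X] [NormedSpace ℝ X] [NormedAddCommGroup Y]
  [NormedSpace ℝ Y] [NormedAddCommGroup Z] [NormedSpace ℝ Z]

theorem intervalIntegrable_bilin (B : X →L[ℝ] Y →L[ℝ] Z) {f : ℝ → X} {g : ℝ → Y} {a b : ℝ}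
    (hf : ContinuousOn f (Set.uIcc a b)) (hg : IntervalIntegrable g volume a b) :
    IntervalIntegrable (fun s => B (f s) (g s)) volume a b := by
  rw [intervalIntegrable_iff] at hg ⊢
  have hmeas : AEStronglyMeasurable f (volume.restrict (Set.uIoc a b)) :=
    (hf.mono Set.uIoc_subset_uIcc).aestronglyMeasurable measurableSet_uIoc
  obtain ⟨C, hC⟩ := (isCompact_uIcc (a := a) (b := b)).exists_bound_of_continuousOn hf
  refine Integrable.mono' (g := fun s => ‖B‖ * C * ‖g s‖) (hg.norm.const_mul _)
    (B.aestronglyMeasurable_comp₂ hmeas hg.aestronglyMeasurable) ?_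
  refine (ae_restrict_iff' measurableSet_uIoc).2 (Filter.Eventually.of_forall fun s hs => ?_)
  refine (B.le_opNorm₂ _ _).trans ?_
  gcongr
  exact hC s (Set.uIoc_subset_uIcc hs)

/-- Integration of a continuous function on `[a, b]` against an integrable weight. -/
noncomputable def weightedIntegralCLM (B : X →L[ℝ] Y →L[ℝ] Z) (g : ℝ → Y) {a b : ℝ} (hab : a ≤ b)
    (hg : IntervalIntegrable g volume a b) : C(Set.Icc a b, X) →L[ℝ] Z :=
  LinearMap.mkContinuous
    { toFun := fun f => ∫ s in a..b, B (Set.IccExtend hab f s) (g s)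
      map_add' := by
        intro f f'
        rw [← intervalIntegral.integral_add
          (intervalIntegrable_bilin B f.continuous.Icc_extend'.continuousOn hg)
          (intervalIntegrable_bilin B f'.continuous.Icc_extend'.continuousOn hg)]
        simp [Set.IccExtend]
      map_smul' := by
        intro c f
        rw [RingHom.id_apply, ← intervalIntegral.integral_smul]
        simp [Set.IccExtend] }
    (‖B‖ * ∫ s in a..b, ‖g s‖) (by
      intro f
      have : ‖∫ s in a..b, B (Set.IccExtend hab f s) (g s)‖
          ≤ ∫ s in a..b, ‖B‖ * ‖f‖ * ‖g s‖ := by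
        refine intervalIntegral.norm_integral_le_of_norm_le hab
          (Filter.Eventually.of_forall fun s _ => ?_) (hg.norm.const_mul _)
        refine (B.le_opNorm₂ _ _).trans ?_
        gcongr
        exact f.norm_coe_le_norm _
      refine this.trans_eq ?_
      rw [intervalIntegral.integral_const_mul]
      ring)

theorem analyticAt_integral_of_hasFPowerSeriesOnBall [CompleteSpace X] (B : X →L[ℝ] Y →L[ℝ] Z)
    {H : ℝ × ℝ → X} {g : ℝ → Y} {t₀ s₀ ρ : ℝ} {r : ENNReal}
    {p : FormalMultilinearSeries ℝ (ℝ × ℝ) X} (hH : HasFPowerSeriesOnBall H p (t₀, s₀) r)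
    (hρ : ENNReal.ofReal ρ < r) {a b : ℝ} (hab : a ≤ b) (ha : s₀ - ρ ≤ a) (hb : b ≤ s₀ + ρ)
    (hg : IntervalIntegrable g volume a b) :
    AnalyticAt ℝ (fun t => ∫ s in a..b, B (H (t, s)) (g s)) t₀ := by
  have hρ0 : 0 ≤ ρ := by linarith
  obtain ⟨Ψ, hΨ⟩ := hH.exists_superposition (I := Set.Icc a b)
  -- The increment `(t - t₀, s - s₀)` from the centre of the power series, regarded as a function of
  -- `s`. It is affine in `t`, so the integral is a composition of an affine curve, the
  -- superposition operator and a continuous linear functional.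
  let path : ℝ → C(Set.Icc a b, ℝ × ℝ) := fun t =>
    ContinuousMap.prodMk ((t - t₀) • (1 : C(Set.Icc a b, ℝ))) ⟨fun s => s - s₀, by fun_prop⟩
  let ι : C(Set.Icc a b, ℝ) →L[ℝ] C(Set.Icc a b, ℝ × ℝ) :=
    (ContinuousLinearMap.inl ℝ ℝ ℝ).compLeftContinuous ℝ _
  let q : C(Set.Icc a b, ℝ × ℝ) := ⟨fun s => (0, s - s₀), by fun_prop⟩
  have hpath : path = fun t => ι ((t - t₀) • (1 : C(Set.Icc a b, ℝ))) + q := by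
    funext t; ext s <;> simp [path, ι, q]
  have hpa : ∀ t, AnalyticAt ℝ path t := by
    intro t
    rw [hpath]
    refine AnalyticAt.add (ι.analyticAt _ |>.comp ?_) analyticAt_const
    exact (analyticAt_id.sub analyticAt_const).smul analyticAt_const
  have hnorm : ∀ t, |t - t₀| ≤ ρ → path t ∈ Metric.eball (0 : C(Set.Icc a b, ℝ × ℝ)) r := by
    intro t ht
    rw [Metric.mem_eball, edist_zero_right, ← ofReal_norm]
    refine lt_of_le_of_lt (ENNReal.ofReal_le_ofReal ?_) hρ
    refine (ContinuousMap.norm_le _ hρ0).2 fun s => ?_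
    have := s.2.1
    have := s.2.2
    simp only [path, ContinuousMap.prod_eval, Prod.norm_def, Real.norm_eq_abs]
    refine max_le (by simpa using ht) ?_
    rw [abs_le]
    constructor <;> simp only [ContinuousMap.coe_mk] <;> linarith
  have h0 : path t₀ ∈ Metric.eball (0 : C(Set.Icc a b, ℝ × ℝ)) r := hnorm t₀ (by simpa using hρ0)
  have hmain : AnalyticAt ℝ (fun t => weightedIntegralCLM B g hab hg (Ψ (path t))) t₀ :=
    ((weightedIntegralCLM B g hab hg).analyticAt _).comp ((hΨ _ h0).1.comp (hpa t₀))
  refine hmain.congr ?_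
  have hev : ∀ᶠ t in nhds t₀, path t ∈ Metric.eball (0 : C(Set.Icc a b, ℝ × ℝ)) r :=
    (hpa t₀).continuousAt.eventually (Metric.isOpen_eball.mem_nhds h0)
  filter_upwards [hev] with t ht
  change ∫ s in a..b, B (Set.IccExtend hab (Ψ (path t)) s) (g s) = _
  refine intervalIntegral.integral_congr fun s hs => ?_
  rw [Set.uIcc_of_le hab] at hs
  rw [Set.IccExtend_of_mem _ _ hs, (hΨ _ ht).2]
  simp [path]

/-- A weighted integral over a compact interval depends analytically on a parameter in which the
integrand is jointly analytic. -/
theorem analyticAt_weighted_integral [CompleteSpace X] (B : X →L[ℝ] Y →L[ℝ] Z)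
    {H : ℝ × ℝ → X} {g : ℝ → Y} {t₀ a b : ℝ} (hab : a ≤ b)
    (hH : ∀ s ∈ Set.Icc a b, AnalyticAt ℝ H (t₀, s)) (hg : IntervalIntegrable g volume a b) :
    AnalyticAt ℝ (fun t => ∫ s in a..b, B (H (t, s)) (g s)) t₀ := by
  have hgi : ∀ {x y : ℝ}, x ∈ Set.Icc a b → y ∈ Set.Icc a b → IntervalIntegrable g volume x y :=
    fun hx hy => hg.mono_set (Set.uIcc_subset_uIcc (by rwa [Set.uIcc_of_le hab])
      (by rwa [Set.uIcc_of_le hab]))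
  have hint : ∀ᶠ t in nhds t₀, ∀ s ∈ Set.Icc a b, ContinuousAt H (t, s) := by
    have := isCompact_Icc.eventually_forall_of_forall_eventually (x₀ := t₀)
      (K := Set.Icc a b) (P := fun t s => ContinuousAt H (t, s)) ?_
    · exact this
    · intro s hs
      exact ((hH s hs).eventually_analyticAt).mono fun z hz => hz.continuousAt
  -- A single power series covers only short intervals of `s`. The relation `P` is symmetric and
  -- transitive and holds locally, so connectedness of `[a, b]` gives it for the end points.
  let P : ℝ → ℝ → Prop := fun x y => AnalyticAt ℝ (fun t => ∫ s in x..y, B (H (t, s)) (g s)) t₀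
  have hsymm : ∀ x y, P x y → P y x := by
    intro x y h
    refine h.neg.congr (Filter.Eventually.of_forall fun t => ?_)
    simp only [Pi.neg_apply]
    rw [intervalIntegral.integral_symm x y]
  refine isPreconnected_Icc.induction₂ (s := Set.Icc a b) P ?_ ?_ (fun x y _ _ => hsymm x y)
    (Set.left_mem_Icc.2 hab) (Set.right_mem_Icc.2 hab)
  · intro s₀ hs₀
    obtain ⟨p, r, hp⟩ := hH s₀ hs₀
    obtain ⟨ρ, hρ0, hρ⟩ : ∃ ρ : ℝ, 0 < ρ ∧ ENNReal.ofReal ρ < r := by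
      obtain ⟨ρ, hρ0, hρ⟩ := ENNReal.lt_iff_exists_nnreal_btwn.1 hp.r_pos
      exact ⟨ρ, by exact_mod_cast hρ0, by simpa using hρ⟩
    filter_upwards [self_mem_nhdsWithin,
      mem_nhdsWithin_of_mem_nhds (Icc_mem_nhds (sub_lt_self s₀ hρ0) (lt_add_of_pos_right s₀ hρ0))]
      with y hy hy'
    rcases le_total s₀ y with h | h
    · exact analyticAt_integral_of_hasFPowerSeriesOnBall B hp hρ h (by linarith) hy'.2
        (hgi hs₀ hy)
    · exact hsymm _ _ (analyticAt_integral_of_hasFPowerSeriesOnBall B hp hρ h hy'.1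
        (by linarith) (hgi hy hs₀))
  · intro x y z hx hy hz hxy hyz
    refine (hxy.add hyz).congr ?_
    filter_upwards [hint] with t ht
    have hc : ∀ {x y : ℝ}, x ∈ Set.Icc a b → y ∈ Set.Icc a b →
        IntervalIntegrable (fun s => B (H (t, s)) (g s)) volume x y := by
      intro x y hx hy
      refine intervalIntegrable_bilin B (fun s hs => ?_) (hgi hx hy)
      have := ht s (Set.uIcc_subset_Icc hx hy hs)
      exact (ContinuousAt.comp (f := fun s => (t, s)) this (by fun_prop)).continuousWithinAt
    exact intervalIntegral.integral_add_adjacent_intervals (hc hx hy) (hc hy hz)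

end ParametricIntegral

/-! ### Analyticity of convolutions over `[0, t]`. -/

section TimeConvolution

variable {X Y Z : Type*} [NormedAddCommGroup X] [NormedSpace ℝ X] [NormedAddCommGroup Y]
  [NormedSpace ℝ Y] [NormedAddCommGroup Z] [NormedSpace ℝ Z]

/-- The convolution over `[0, t]` of two functions of time, with respect to a bilinear map. -/
noncomputable def timeConv (B : X →L[ℝ] Y →L[ℝ] Z) (f : ℝ → X) (g : ℝ → Y) (t : ℝ) : Z :=
  ∫ s in (0 : ℝ)..t, B (f (t - s)) (g s)

/-- Functions of time which are analytic on `(0, ∞)` and integrable near `0`. -/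
structure AnalyticIntegrable (g : ℝ → Y) : Prop where
  analytic : AnalyticOnNhd ℝ g (Set.Ioi 0)
  integrable : ∀ t, 0 < t → IntervalIntegrable g volume 0 t

/-- Functions of time which are analytic on `(0, ∞)` and bounded near `0`. -/
structure AnalyticBounded (f : ℝ → X) : Prop where
  analytic : AnalyticOnNhd ℝ f (Set.Ioi 0)
  bounded : ∀ T, 0 < T → ∃ M, ∀ t, 0 < t → t ≤ T → ‖f t‖ ≤ M

theorem AnalyticBounded.bounded' {f : ℝ → X} (hf : AnalyticBounded f) (T : ℝ) :
    ∃ M, 0 ≤ M ∧ ∀ t, 0 < t → t ≤ T → ‖f t‖ ≤ M := by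
  obtain ⟨M, hM⟩ := hf.bounded (max T 1) (by positivity)
  exact ⟨max M 0, le_max_right _ _, fun t h0 h1 =>
    (hM t h0 (h1.trans (le_max_left _ _))).trans (le_max_left _ _)⟩

theorem AnalyticBounded.integrable {f : ℝ → X} (hf : AnalyticBounded f) (t : ℝ) (ht : 0 < t) :
    IntervalIntegrable f volume 0 t := by
  obtain ⟨M, -, hM⟩ := hf.bounded' t
  rw [intervalIntegrable_iff_integrableOn_Ioc_of_le ht.le]
  refine Integrable.mono' (g := fun _ => M) (integrableOn_const (by simp))
    ((hf.analytic.continuousOn.mono fun s hs => hs.1).aestronglyMeasurable measurableSet_Ioc) ?_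
  exact (ae_restrict_iff' measurableSet_Ioc).2 (Filter.Eventually.of_forall fun s hs =>
    hM s hs.1 hs.2)

theorem AnalyticBounded.analyticIntegrable {f : ℝ → X} (hf : AnalyticBounded f) :
    AnalyticIntegrable f := ⟨hf.analytic, hf.integrable⟩

theorem AnalyticBounded.clm_comp {f : ℝ → X} (hf : AnalyticBounded f) (φ : X →L[ℝ] Y) :
    AnalyticBounded fun t => φ (f t) := by
  refine ⟨fun t ht => (φ.analyticAt _).comp (hf.analytic t ht), fun T hT => ?_⟩
  obtain ⟨M, hM⟩ := hf.bounded T hT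
  refine ⟨‖φ‖ * M, fun t h0 h1 => (φ.le_opNorm _).trans ?_⟩
  gcongr
  exact hM t h0 h1

theorem AnalyticBounded.const_smul {f : ℝ → X} (hf : AnalyticBounded f) (c : ℝ) :
    AnalyticBounded fun t => c • f t :=
  hf.clm_comp (c • ContinuousLinearMap.id ℝ X)

theorem AnalyticBounded.add {f g : ℝ → X} (hf : AnalyticBounded f) (hg : AnalyticBounded g) :
    AnalyticBounded fun t => f t + g t := by
  refine ⟨fun t ht => (hf.analytic t ht).add (hg.analytic t ht), fun T hT => ?_⟩
  obtain ⟨M, hM⟩ := hf.bounded T hT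
  obtain ⟨N, hN⟩ := hg.bounded T hT
  exact ⟨M + N, fun t h0 h1 => (norm_add_le _ _).trans (add_le_add (hM t h0 h1) (hN t h0 h1))⟩

theorem AnalyticBounded.bilin {f : ℝ → X} {g : ℝ → Y} (B : X →L[ℝ] Y →L[ℝ] Z)
    (hf : AnalyticBounded f) (hg : AnalyticBounded g) :
    AnalyticBounded fun t => B (f t) (g t) := by
  refine ⟨fun t ht => (B.analyticAt_bilinear _).comp ((hf.analytic t ht).prod (hg.analytic t ht)),
    fun T hT => ?_⟩
  obtain ⟨M, hM0, hM⟩ := hf.bounded' T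
  obtain ⟨N, hN0, hN⟩ := hg.bounded' T
  refine ⟨‖B‖ * M * N, fun t h0 h1 => (B.le_opNorm₂ _ _).trans ?_⟩
  gcongr
  · exact hM t h0 h1
  · exact hN t h0 h1

theorem AnalyticBounded.prodMk {f : ℝ → X} {g : ℝ → Y} (hf : AnalyticBounded f)
    (hg : AnalyticBounded g) : AnalyticBounded fun t => (f t, g t) := by
  have h1 := hf.clm_comp (ContinuousLinearMap.inl ℝ X Y)
  have h2 := hg.clm_comp (ContinuousLinearMap.inr ℝ X Y)
  simpa using h1.add h2

theorem AnalyticBounded.pi {ι : Type*} [Fintype ι] {f : ι → ℝ → X}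
    (hf : ∀ i, AnalyticBounded (f i)) : AnalyticBounded fun t i => f i t := by
  refine ⟨fun t ht => AnalyticAt.pi fun i => (hf i).analytic t ht, fun T hT => ?_⟩
  choose M hM0 hM using fun i => (hf i).bounded' T
  refine ⟨∑ i, M i, fun t h0 h1 => ?_⟩
  refine (pi_norm_le_iff_of_nonneg (Finset.sum_nonneg fun i _ => hM0 i)).2 fun i => ?_
  exact (hM i t h0 h1).trans (Finset.single_le_sum (fun i _ => hM0 i) (Finset.mem_univ i))

theorem AnalyticBounded.of_analytic {f : ℝ → X} (hf : ∀ t, AnalyticAt ℝ f t) :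
    AnalyticBounded f := by
  refine ⟨fun t _ => hf t, fun T _ => ?_⟩
  obtain ⟨C, hC⟩ := (isCompact_Icc (a := (0 : ℝ)) (b := T)).exists_bound_of_continuousOn
    (f := f) fun t _ => (hf t).continuousAt.continuousWithinAt
  exact ⟨C, fun t h0 h1 => hC t ⟨h0.le, h1⟩⟩

theorem intervalIntegrable_timeConv (B : X →L[ℝ] Y →L[ℝ] Z) {f : ℝ → X} {g : ℝ → Y}
    (hf : AnalyticBounded f) (hg : AnalyticIntegrable g) {t : ℝ} (ht : 0 < t) :
    IntervalIntegrable (fun s => B (f (t - s)) (g s)) volume 0 t := by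
  obtain ⟨M, hM0, hM⟩ := hf.bounded' t
  have hg' := (intervalIntegrable_iff_integrableOn_Ioo_of_le ht.le).1 (hg.integrable t ht)
  rw [intervalIntegrable_iff_integrableOn_Ioo_of_le ht.le]
  have hmeas : AEStronglyMeasurable (fun s => f (t - s)) (volume.restrict (Set.Ioo 0 t)) := by
    refine ContinuousOn.aestronglyMeasurable (fun s hs => ?_) measurableSet_Ioo
    have h1 : ContinuousAt f (t - s) := (hf.analytic _ (sub_pos.2 hs.2)).continuousAt
    exact (ContinuousAt.comp (f := fun s => t - s) h1 (by fun_prop)).continuousWithinAt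
  refine Integrable.mono' (g := fun s => ‖B‖ * M * ‖g s‖) (hg'.norm.const_mul _)
    (B.aestronglyMeasurable_comp₂ hmeas hg'.aestronglyMeasurable) ?_
  refine (ae_restrict_iff' measurableSet_Ioo).2 (Filter.Eventually.of_forall fun s hs => ?_)
  refine (B.le_opNorm₂ _ _).trans ?_
  gcongr
  exact hM _ (sub_pos.2 hs.2) (by linarith [hs.1])

theorem timeConv_bounded (B : X →L[ℝ] Y →L[ℝ] Z) {f : ℝ → X} {g : ℝ → Y}
    (hf : AnalyticBounded f) (hg : AnalyticBounded g) (T : ℝ) :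
    ∃ M, ∀ t, 0 < t → t ≤ T → ‖timeConv B f g t‖ ≤ M := by
  obtain ⟨M, hM0, hM⟩ := hf.bounded' T
  obtain ⟨N, hN0, hN⟩ := hg.bounded' T
  refine ⟨‖B‖ * M * N * T, fun t h0 h1 => ?_⟩
  have : ‖timeConv B f g t‖ ≤ ‖B‖ * M * N * |t - 0| := by
    refine intervalIntegral.norm_integral_le_of_norm_le_const_ae ?_
    have hne : ∀ᵐ s : ℝ, s ≠ t := by simp [ae_iff, measure_singleton]
    filter_upwards [hne] with s hst hs
    rw [Set.uIoc_of_le h0.le] at hs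
    have hlt : s < t := lt_of_le_of_ne hs.2 hst
    refine (B.le_opNorm₂ _ _).trans ?_
    gcongr
    · exact hM _ (sub_pos.2 hlt) (by linarith [hs.1])
    · exact hN _ hs.1 (by linarith)
  refine this.trans ?_
  rw [sub_zero, abs_of_pos h0]
  gcongr

theorem clm_timeConv [CompleteSpace Z] {Z' : Type*} [NormedAddCommGroup Z'] [NormedSpace ℝ Z'] [CompleteSpace Z']
    (B : X →L[ℝ] Y →L[ℝ] Z) {f : ℝ → X} {g : ℝ → Y}
    (hf : AnalyticBounded f) (hg : AnalyticIntegrable g) (φ : Z →L[ℝ] Z') {t : ℝ} (ht : 0 < t) :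
    φ (timeConv B f g t) = ∫ s in (0 : ℝ)..t, φ (B (f (t - s)) (g s)) :=
  (φ.intervalIntegral_comp_comm (intervalIntegrable_timeConv B hf hg ht)).symm

variable [CompleteSpace X] [CompleteSpace Y] [CompleteSpace Z]

/-- Both `f (t - s)` and `g s` may be singular at one end of `[0, t]`. Cutting near both ends and
substituting `s ↦ t - s` at the far end puts `t` into the factor that is analytic there, while the
other factor is a fixed integrable weight. -/
theorem timeConv_analytic (B : X →L[ℝ] Y →L[ℝ] Z) {f : ℝ → X} {g : ℝ → Y}
    (hf : AnalyticBounded f) (hg : AnalyticIntegrable g) :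
    AnalyticOnNhd ℝ (timeConv B f g) (Set.Ioi 0) := by
  intro t₀ ht₀
  rw [Set.mem_Ioi] at ht₀
  -- With this cut the middle piece `[c, t - c]` shrinks to a point at `t = t₀`, so both of its
  -- arguments stay near `c`, where `f` and `g` are analytic.
  set c := t₀ / 2 with hc
  have hc0 : 0 < c := by positivity
  have h1 : AnalyticAt ℝ (fun t => ∫ s in (0 : ℝ)..c, B (f (t - s)) (g s)) t₀ := by
    refine analyticAt_weighted_integral B (H := fun z => f (z.1 - z.2)) hc0.le (fun s hs => ?_)
      (hg.integrable c hc0)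
    exact (hf.analytic _ (by have := hs.2; simp only [Set.mem_Ioi]; linarith)).comp_of_eq
      (analyticAt_fst.sub analyticAt_snd) rfl
  have h2 : AnalyticAt ℝ (fun t => ∫ s in (0 : ℝ)..c, B.flip (g (t - s)) (f s)) t₀ := by
    refine analyticAt_weighted_integral B.flip (H := fun z => g (z.1 - z.2)) hc0.le
      (fun s hs => ?_) (hf.integrable c hc0)
    exact (hg.analytic _ (by have := hs.2; simp only [Set.mem_Ioi]; linarith)).comp_of_eq
      (analyticAt_fst.sub analyticAt_snd) rfl
  -- The middle piece, rescaled to a fixed interval by `s = c + (t - t₀) θ`; as `t₀ = 2 c`, the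
  -- other argument `t - s` becomes `c + (t - t₀) (1 - θ)`. The formula remains valid when `t < t₀`,
  -- with reversed orientation.
  have h3 : AnalyticAt ℝ (fun t => (t - t₀) • ∫ θ in (0 : ℝ)..1,
      (ContinuousLinearMap.lsmul ℝ ℝ).flip (B (f (c + (t - t₀) * θ))
        (g (c + (t - t₀) * (1 - θ)))) 1) t₀ := by
    refine (analyticAt_id.sub analyticAt_const).smul ?_
    refine analyticAt_weighted_integral (ContinuousLinearMap.lsmul ℝ ℝ).flip
      (H := fun z => B (f (c + (z.1 - t₀) * z.2)) (g (c + (z.1 - t₀) * (1 - z.2))))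
      (g := fun _ => (1 : ℝ)) zero_le_one (fun s _ => ?_) (by simp)
    refine (B.analyticAt_bilinear _).comp (AnalyticAt.prod ?_ ?_)
    · exact (hf.analytic c hc0).comp_of_eq (analyticAt_const.add
        ((analyticAt_fst.sub analyticAt_const).mul analyticAt_snd)) (by simp)
    · exact (hg.analytic c hc0).comp_of_eq (analyticAt_const.add
        ((analyticAt_fst.sub analyticAt_const).mul (analyticAt_const.sub analyticAt_snd)))
        (by simp)
  refine ((h1.add h2).add h3).congr ?_
  filter_upwards [lt_mem_nhds (show c < t₀ by linarith)] with t ht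
  have ht0 : 0 < t := hc0.trans ht
  have hI := intervalIntegrable_timeConv B hf hg ht0
  have e3 : (t - t₀) • ∫ θ in (0 : ℝ)..1, (ContinuousLinearMap.lsmul ℝ ℝ).flip
      (B (f (c + (t - t₀) * θ)) (g (c + (t - t₀) * (1 - θ)))) 1
      = ∫ s in c..(t - c), B (f s) (g (t - s)) := by
    have := intervalIntegral.smul_integral_comp_add_mul (a := 0) (b := 1)
      (fun s => B (f s) (g (t - s))) (t - t₀) c
    rw [mul_zero, add_zero, mul_one, show c + (t - t₀) = t - c by rw [hc]; ring] at this
    rw [← this]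
    congr 1
    refine intervalIntegral.integral_congr fun θ _ => ?_
    simp only [ContinuousLinearMap.flip_apply, ContinuousLinearMap.lsmul_apply, one_smul]
    congr 2
    rw [hc]; ring
  have hI' : IntervalIntegrable (fun s => B (f s) (g (t - s))) volume 0 t := by
    have := hI.comp_sub_left t
    simp only [sub_sub_cancel, sub_zero, sub_self] at this
    exact this.symm
  have e2 : (∫ s in (0 : ℝ)..c, B (f s) (g (t - s))) + ∫ s in c..(t - c), B (f s) (g (t - s))
      = ∫ s in c..t, B (f (t - s)) (g s) := by
    rw [intervalIntegral.integral_add_adjacent_intervals]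
    · have := intervalIntegral.integral_comp_sub_left (a := c) (b := t)
        (fun s => B (f s) (g (t - s))) t
      simp only [sub_sub_cancel, sub_self] at this
      exact this.symm
    · exact hI'.mono_set (Set.uIcc_subset_uIcc Set.left_mem_uIcc
        (Set.mem_uIcc_of_le hc0.le ht.le))
    · exact hI'.mono_set (Set.uIcc_subset_uIcc (Set.mem_uIcc_of_le hc0.le ht.le)
        (Set.mem_uIcc_of_le (by linarith) (by linarith)))
  simp only [Pi.add_apply]
  rw [e3]
  simp only [ContinuousLinearMap.flip_apply]
  rw [add_assoc, e2]
  exact intervalIntegral.integral_add_adjacent_intervals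
    (hI.mono_set (Set.uIcc_subset_uIcc Set.left_mem_uIcc (Set.mem_uIcc_of_le hc0.le ht.le)))
    (hI.mono_set (Set.uIcc_subset_uIcc (Set.mem_uIcc_of_le hc0.le ht.le) Set.right_mem_uIcc))

theorem AnalyticBounded.timeConv (B : X →L[ℝ] Y →L[ℝ] Z) {f : ℝ → X} {g : ℝ → Y}
    (hf : AnalyticBounded f) (hg : AnalyticBounded g) : AnalyticBounded (timeConv B f g) :=
  ⟨timeConv_analytic B hf hg.analyticIntegrable, fun T _ => timeConv_bounded B hf hg T⟩

end TimeConvolution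

/-! ### Zero sets of analytic families as Lipschitz graphs, and the dimension count. -/

section LipschitzGraphs

open Topology NNReal

variable {E W : Type*} [NormedAddCommGroup E] [NormedSpace ℝ E] [MetricSpace W]

/-- A set of pairs which is the graph of a Lipschitz function of the first component. -/
def IsLipschitzGraph (S : Set (W × ℝ)) : Prop :=
  ∃ K : ℝ≥0, ∀ p ∈ S, ∀ q ∈ S, dist p.2 q.2 ≤ K * dist p.1 q.1

/-- A set of pairs covered by countably many Lipschitz graphs. -/
def IsCountablyLipschitzGraph (Z : Set (W × ℝ)) : Prop :=
  ∃ 𝒮 : Set (Set (W × ℝ)), 𝒮.Countable ∧ (∀ S ∈ 𝒮, IsLipschitzGraph S) ∧ Z ⊆ ⋃₀ 𝒮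

theorem IsCountablyLipschitzGraph.mono {Z Z' : Set (W × ℝ)} (h : IsCountablyLipschitzGraph Z)
    (hZ : Z' ⊆ Z) : IsCountablyLipschitzGraph Z' := by
  obtain ⟨𝒮, h1, h2, h3⟩ := h
  exact ⟨𝒮, h1, h2, hZ.trans h3⟩

theorem IsCountablyLipschitzGraph.biUnion {ι : Type*} {t : Set ι} (ht : t.Countable)
    {Z : ι → Set (W × ℝ)} (h : ∀ i ∈ t, IsCountablyLipschitzGraph (Z i)) :
    IsCountablyLipschitzGraph (⋃ i ∈ t, Z i) := by
  choose! 𝒮 h1 h2 h3 using h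
  refine ⟨⋃ i ∈ t, 𝒮 i, ht.biUnion h1, ?_, ?_⟩
  · intro S hS
    simp only [Set.mem_iUnion] at hS
    obtain ⟨i, hi, hS⟩ := hS
    exact h2 i hi S hS
  · intro z hz
    simp only [Set.mem_iUnion] at hz
    obtain ⟨i, hi, hz⟩ := hz
    obtain ⟨S, hS, hzS⟩ := h3 i hi hz
    exact ⟨S, Set.mem_biUnion hi hS, hzS⟩

theorem IsCountablyLipschitzGraph.of_local [SecondCountableTopology W] {Z : Set (W × ℝ)}
    (h : ∀ z ∈ Z, ∃ U ∈ 𝓝[Z] z, IsLipschitzGraph U) : IsCountablyLipschitzGraph Z := by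
  choose! U hU hL using h
  obtain ⟨t, htZ, ht, hcov⟩ := TopologicalSpace.countable_cover_nhdsWithin hU
  refine ⟨U '' t, ht.image _, ?_, ?_⟩
  · rintro _ ⟨z, hz, rfl⟩
    exact hL z (htZ hz)
  · intro z hz
    obtain ⟨y, hy, hzy⟩ := Set.mem_iUnion₂.1 (hcov hz)
    exact ⟨_, ⟨y, hy, rfl⟩, hzy⟩

/-- The partial derivative with respect to the last variable. -/
noncomputable def timeDeriv (G : E × ℝ → ℝ) (x : E × ℝ) : ℝ := fderiv ℝ G x (0, 1)

theorem analyticOnNhd_timeDeriv_iterate {G : E × ℝ → ℝ} {U : Set (E × ℝ)}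
    (hG : AnalyticOnNhd ℝ G U) (j : ℕ) : AnalyticOnNhd ℝ (timeDeriv^[j] G) U := by
  induction j with
  | zero => exact hG
  | succ j ih =>
    rw [Function.iterate_succ_apply']
    exact fun x hx => ((ContinuousLinearMap.apply ℝ ℝ ((0, 1) : E × ℝ)).analyticAt _).comp
      (ih.fderiv x hx)

theorem AnalyticAt.hasDerivAt_timeDeriv {G : E × ℝ → ℝ} {x : E} {t : ℝ}
    (hG : AnalyticAt ℝ G (x, t)) : HasDerivAt (fun t => G (x, t)) (timeDeriv G (x, t)) t := by
  have h1 : HasDerivAt (fun t : ℝ => (x, t)) ((0, 1) : E × ℝ) t :=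
    (hasDerivAt_const t x).prodMk (hasDerivAt_id t)
  exact hG.differentiableAt.hasFDerivAt.comp_hasDerivAt t h1

theorem iteratedDeriv_eventuallyEq_timeDeriv {G : E × ℝ → ℝ} {s : Set ℝ} (hs : IsOpen s)
    (hG : AnalyticOnNhd ℝ G (Set.univ ×ˢ s)) (x : E) (j : ℕ) :
    ∀ t ∈ s, iteratedDeriv j (fun t => G (x, t)) t = timeDeriv^[j] G (x, t) := by
  induction j with
  | zero => simp
  | succ j ih =>
    intro t ht
    rw [iteratedDeriv_succ, Function.iterate_succ_apply']
    have : iteratedDeriv j (fun t => G (x, t)) =ᶠ[𝓝 t] fun t => timeDeriv^[j] G (x, t) :=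
      Filter.eventually_of_mem (hs.mem_nhds ht) ih
    rw [this.deriv_eq]
    exact (analyticOnNhd_timeDeriv_iterate hG j (x, t) ⟨trivial, ht⟩).hasDerivAt_timeDeriv.deriv

/-- The identity theorem: a zero of infinite order would force `G (x, ·)` to vanish on the whole
connected set `s`, including `t₀`. -/
theorem exists_timeDeriv_ne_zero {G : E × ℝ → ℝ} {s : Set ℝ} (hs : IsOpen s)
    (hs' : IsPreconnected s) (hG : AnalyticOnNhd ℝ G (Set.univ ×ˢ s)) {x : E} {t₀ : ℝ}
    (ht₀ : t₀ ∈ s) (hne : G (x, t₀) ≠ 0) {t : ℝ} (ht : t ∈ s) :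
    ∃ j, timeDeriv^[j] G (x, t) ≠ 0 := by
  by_contra! hzero
  have han : AnalyticOnNhd ℝ (fun t => G (x, t)) s := fun t ht =>
    (hG (x, t) ⟨trivial, ht⟩).comp_of_eq (analyticAt_const.prod analyticAt_id) rfl
  have htop : analyticOrderAt (fun t => G (x, t)) t = ⊤ := by
    rw [ENat.eq_top_iff_forall_ge]
    intro n
    rw [natCast_le_analyticOrderAt_iff_iteratedDeriv_eq_zero (han t ht)]
    intro i _
    rw [iteratedDeriv_eventuallyEq_timeDeriv hs hG x i t ht]
    exact hzero i
  exact hne (han.eqOn_zero_of_preconnected_of_eventuallyEq_zero hs' ht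
    (analyticOrderAt_eq_top.1 htop) ht₀)

/-- A quantitative substitute for the implicit function theorem when `L` is merely Lipschitz: a
lower bound on the time derivative and a Lipschitz bound in the parameter control the distance
between zeros. Existence of a zero over each parameter is not needed. -/
theorem exists_lipschitzGraph_nhdsWithin {g : E × ℝ → ℝ} {L : W → E} {N : Set W} {C : ℝ≥0}
    (hL : LipschitzOnWith C L N) {b : W} (hb : b ∈ N) {t : ℝ}
    (hg : AnalyticAt ℝ g (L b, t)) (h1 : timeDeriv g (L b, t) ≠ 0) :
    ∃ U ∈ 𝓝 (b, t), IsLipschitzGraph {z | z ∈ U ∧ z.1 ∈ N ∧ g (L z.1, z.2) = 0} := by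
  obtain ⟨K, V, hV, hK⟩ := (hg.contDiffAt (n := 1)).exists_lipschitzOnWith
  set c := |timeDeriv g (L b, t)| / 2 with hc
  have hc0 : 0 < c := by positivity
  have hd : ContinuousAt (fun z => |timeDeriv g z|) (L b, t) := by
    have : ContinuousAt (timeDeriv g) (L b, t) :=
      (((ContinuousLinearMap.apply ℝ ℝ ((0, 1) : E × ℝ)).analyticAt _).comp
        hg.fderiv).continuousAt
    exact this.abs
  have hd' : ∀ᶠ z in 𝓝 (L b, t), c < |timeDeriv g z| :=
    hd.eventually (lt_mem_nhds (by rw [hc]; linarith [abs_pos.2 h1]))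
  obtain ⟨ε, hε, hball⟩ := Metric.eventually_nhds_iff.1
    ((hd'.and hg.eventually_analyticAt).and hV)
  have hin : ∀ x s, dist x (L b) < ε → |s - t| < ε → dist ((x, s) : E × ℝ) (L b, t) < ε :=
    fun x s hx hs => by rw [Prod.dist_eq]; exact max_lt hx (by simpa [Real.dist_eq] using hs)
  have hcont : ∀ᶠ b' in 𝓝[N] b, dist (L b') (L b) < ε :=
    (hL.continuousOn b hb).eventually (Metric.ball_mem_nhds _ hε)
  rw [eventually_nhdsWithin_iff] at hcont
  refine ⟨{b' | b' ∈ N → dist (L b') (L b) < ε} ×ˢ Metric.ball t ε,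
    prod_mem_nhds hcont (Metric.ball_mem_nhds _ hε), ⟨Real.toNNReal (c⁻¹ * (K * C)), ?_⟩⟩
  rintro ⟨b₁, t₁⟩ ⟨⟨hb1, ht1⟩, hN1, hz1⟩ ⟨b₂, t₂⟩ ⟨⟨hb2, ht2⟩, hN2, hz2⟩
  simp only [Metric.mem_ball, Real.dist_eq] at ht1 ht2 hz1 hz2 hN1 hN2 ⊢
  replace hb1 := hb1 hN1
  replace hb2 := hb2 hN2
  have key : ∀ s s', s < s' → |s - t| < ε → |s' - t| < ε →
      c * (s' - s) ≤ |g (L b₂, s') - g (L b₂, s)| := by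
    intro s s' hss hs hs'
    have hmem : ∀ r ∈ Set.Icc s s', |r - t| < ε := by
      intro r hr
      rw [abs_lt] at *
      constructor <;> linarith [hr.1, hr.2, hs.1, hs'.2]
    have hder : ∀ r ∈ Set.Icc s s', HasDerivAt (fun r => g (L b₂, r))
        (timeDeriv g (L b₂, r)) r := fun r hr =>
      (hball (hin _ _ hb2 (hmem r hr))).1.2.hasDerivAt_timeDeriv
    obtain ⟨r, hr, he⟩ := exists_hasDerivAt_eq_slope _ _ hss
      (fun r hr => (hder r hr).continuousAt.continuousWithinAt)
      (fun r hr => hder r (Set.Ioo_subset_Icc_self hr))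
    have hlow := (hball (hin _ _ hb2 (hmem r (Set.Ioo_subset_Icc_self hr)))).1.1
    rw [he, abs_div, abs_of_pos (sub_pos.2 hss), lt_div_iff₀ (sub_pos.2 hss)] at hlow
    exact hlow.le
  have key' : c * |t₁ - t₂| ≤ |g (L b₂, t₁) - g (L b₂, t₂)| := by
    rcases lt_trichotomy t₁ t₂ with h | h | h
    · rw [abs_sub_comm t₁, abs_sub_comm (g _), abs_of_pos (sub_pos.2 h)]
      exact key _ _ h ht1 ht2
    · simp [h]
    · rw [abs_of_pos (sub_pos.2 h)]
      exact key _ _ h ht2 ht1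
  -- Both zeros have value 0, so `g (L b₂, t₂)` may be replaced by `g (L b₁, t₁)`; only the
  -- parameter then differs.
  have hlip : |g (L b₂, t₁) - g (L b₂, t₂)| ≤ K * (C * dist b₁ b₂) := by
    rw [hz2, ← hz1, ← Real.dist_eq]
    refine (hK.dist_le_mul _ (hball (hin _ _ hb2 ht1)).2 _ (hball (hin _ _ hb1 ht1)).2).trans ?_
    gcongr
    rw [Prod.dist_eq, dist_self, max_eq_left dist_nonneg, dist_comm b₁]
    exact hL.dist_le_mul _ hN2 _ hN1
  have := key'.trans hlip
  rw [Real.coe_toNNReal _ (by positivity), mul_assoc, mul_assoc, ← div_eq_inv_mul, le_div_iff₀ hc0]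
  linarith

/-- The zeros in `t` of a family of analytic functions of `t`, none of which vanishes identically,
form countably many Lipschitz graphs over the parameter space. -/
theorem isCountablyLipschitzGraph_zeros [SecondCountableTopology W] {G : E × ℝ → ℝ}
    {s : Set ℝ} (hs : IsOpen s) (hs' : IsPreconnected s)
    (hG : AnalyticOnNhd ℝ G (Set.univ ×ˢ s)) {L : W → E} {N : Set W} {C : ℝ≥0}
    (hL : LipschitzOnWith C L N) {t₀ : ℝ} (ht₀ : t₀ ∈ s) (hne : ∀ b ∈ N, G (L b, t₀) ≠ 0) :
    IsCountablyLipschitzGraph {z : W × ℝ | z.1 ∈ N ∧ z.2 ∈ s ∧ G (L z.1, z.2) = 0} := by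
  -- At a zero of order `j + 1` the `j`-th time derivative has a simple zero, to which the local
  -- lemma applies.
  let Z : ℕ → Set (W × ℝ) := fun j => {z | z.1 ∈ N ∧ z.2 ∈ s ∧ timeDeriv^[j] G (L z.1, z.2) = 0 ∧
    timeDeriv^[j + 1] G (L z.1, z.2) ≠ 0}
  have hZ : ∀ j, IsCountablyLipschitzGraph (Z j) := by
    intro j
    refine .of_local ?_
    rintro ⟨b, t⟩ ⟨hb, ht, h0, h1⟩
    rw [Function.iterate_succ_apply'] at h1
    obtain ⟨U, hU, hgr⟩ := exists_lipschitzGraph_nhdsWithin hL hb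
      (analyticOnNhd_timeDeriv_iterate hG j (L b, t) ⟨trivial, ht⟩) h1
    refine ⟨_, ?_, hgr⟩
    filter_upwards [mem_nhdsWithin_of_mem_nhds hU, self_mem_nhdsWithin] with z hzU hz
    exact ⟨hzU, hz.1, hz.2.2.1⟩
  refine (IsCountablyLipschitzGraph.biUnion Set.countable_univ fun j _ => hZ j).mono ?_
  rintro ⟨b, t⟩ ⟨hb, ht, h0⟩
  have hex := exists_timeDeriv_ne_zero hs hs' hG ht₀ (hne b hb) ht
  classical
  obtain ⟨j, hj⟩ : ∃ j, Nat.find hex = j + 1 := by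
    refine Nat.exists_eq_succ_of_ne_zero fun h => ?_
    have := Nat.find_spec hex
    rw [h] at this
    exact this h0
  refine Set.mem_biUnion (Set.mem_univ j) ⟨hb, ht, ?_, ?_⟩
  · have := Nat.find_min hex (m := j) (by omega)
    simpa using this
  · have := Nat.find_spec hex
    rwa [hj] at this

/-- Over a parameter space of dimension less than `n`, the `n`-tuples of numbers which are all
attained at one parameter by a countable family of Lipschitz graphs are nowhere dense. -/
theorem dense_setOf_forall_exists_notMem {n : ℕ} {Z : Set (W × ℝ)}
    (hZ : IsCountablyLipschitzGraph Z) (hdim : dimH (Set.univ : Set W) < n) :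
    Dense {τ : Fin n → ℝ | ∀ b, ∃ k, (b, τ k) ∉ Z} := by
  obtain ⟨𝒮, hc, hgr, hcov⟩ := hZ
  have : Countable 𝒮 := hc.to_subtype
  -- Once a graph is fixed for every index, the parameter `b` determines the whole tuple, and does
  -- so in a Lipschitz way. There are countably many choices `σ`.
  let A : (Fin n → 𝒮) → Set (Fin n → ℝ) := fun σ => {τ | ∃ b, ∀ k, (b, τ k) ∈ (σ k : Set (W × ℝ))}
  have hA : ∀ σ, dimH (A σ) ≤ dimH (Set.univ : Set W) := by
    intro σ
    choose K hK using fun k => hgr (σ k) (σ k).2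
    let P : Set W := {b | ∃ τ : Fin n → ℝ, ∀ k, (b, τ k) ∈ (σ k : Set (W × ℝ))}
    have hP : ∀ b ∈ P, ∃ τ : Fin n → ℝ, ∀ k, (b, τ k) ∈ (σ k : Set (W × ℝ)) := fun b hb => hb
    choose! τ hτ using hP
    have himg : A σ ⊆ τ '' P := by
      rintro τ' ⟨b, hb⟩
      refine ⟨b, ⟨τ', hb⟩, funext fun k => ?_⟩
      have := hK k _ (hτ b ⟨τ', hb⟩ k) _ (hb k)
      simpa using this
    have hlip : LipschitzOnWith (∑ k, K k) τ P := by
      refine LipschitzOnWith.of_dist_le_mul fun b hb b' hb' => ?_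
      refine (dist_pi_le_iff (by positivity)).2 fun k => ?_
      refine (hK k _ (hτ b hb k) _ (hτ b' hb' k)).trans ?_
      gcongr
      exact Finset.single_le_sum (f := K) (fun i _ => zero_le) (Finset.mem_univ k)
    exact (dimH_mono himg).trans (hlip.dimH_image_le.trans (dimH_mono (Set.subset_univ _)))
  have hdimA : dimH (⋃ σ, A σ) < Module.finrank ℝ (Fin n → ℝ) := by
    rw [dimH_iUnion, Module.finrank_fin_fun]
    exact lt_of_le_of_lt (iSup_le hA) hdim
  refine (dense_compl_of_dimH_lt_finrank hdimA).mono fun τ hτ b => ?_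
  by_contra! hall
  refine hτ ?_
  choose S hS hbS using fun k => hcov (hall k)
  exact Set.mem_iUnion.2 ⟨fun k => ⟨S k, hS k⟩, b, hbS⟩

end LipschitzGraphs

/-! ### The error function, and derivatives and bounds of the excitation light. -/

noncomputable section

namespace FDOT

section ErrorFunction

theorem integrable_exp_neg_sq : Integrable fun s : ℝ => Real.exp (-s ^ 2) := by
  simpa using integrable_exp_neg_mul_sq zero_lt_one

theorem integral_exp_neg_sq_Ioi : ∫ s in Set.Ioi (0 : ℝ), Real.exp (-s ^ 2) = √Real.pi / 2 := by
  simpa using integral_gaussian_Ioi 1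

theorem erfc_eq_sub (ξ : ℝ) :
    erfc ξ = 1 - 2 / √Real.pi * ∫ s in (0 : ℝ)..ξ, Real.exp (-s ^ 2) := by
  have h := intervalIntegral.integral_Ioi_sub_Ioi' (a := 0) (b := ξ)
    (integrable_exp_neg_sq.integrableOn) (integrable_exp_neg_sq.integrableOn)
  rw [integral_exp_neg_sq_Ioi] at h
  have hpi : √Real.pi ≠ 0 := by positivity
  rw [erfc, ← h]
  field_simp
  ring

theorem hasDerivAt_erfc (ξ : ℝ) : HasDerivAt erfc (-(2 / √Real.pi * Real.exp (-ξ ^ 2))) ξ := by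
  have hc : Continuous fun s : ℝ => Real.exp (-s ^ 2) := by fun_prop
  have h := ((hc.integral_hasStrictDerivAt 0 ξ).hasDerivAt.const_mul (2 / √Real.pi)).const_sub 1
  exact h.congr_of_eventuallyEq (Filter.Eventually.of_forall erfc_eq_sub)

theorem continuous_erfc : Continuous erfc :=
  continuous_iff_continuousAt.2 fun ξ => (hasDerivAt_erfc ξ).continuousAt

theorem erfc_eq_integral (ξ : ℝ) :
    erfc ξ = 1 - 2 / √Real.pi * (ξ * ∫ θ in (0 : ℝ)..1, Real.exp (-(θ ^ 2 * ξ ^ 2))) := by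
  have h := intervalIntegral.smul_integral_comp_mul_left (a := 0) (b := 1)
    (fun s : ℝ => Real.exp (-s ^ 2)) ξ
  simp only [mul_zero, mul_one, smul_eq_mul] at h
  rw [erfc_eq_sub, ← h]
  simp only [mul_pow, mul_comm (ξ ^ 2)]

theorem erfc_nonneg (ξ : ℝ) : 0 ≤ erfc ξ :=
  mul_nonneg (by positivity) (setIntegral_nonneg measurableSet_Ioi fun _ _ => (Real.exp_pos _).le)

/-- After shifting the integral to start at 0, use `(r + ξ) ^ 2 ≥ r ^ 2 + ξ ^ 2` for `r, ξ ≥ 0`. -/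
theorem erfc_le_exp {ξ : ℝ} (hξ : 0 ≤ ξ) : erfc ξ ≤ Real.exp (-ξ ^ 2) := by
  have h1 : ∫ s in Set.Ioi ξ, Real.exp (-s ^ 2) = ∫ r in Set.Ioi (0 : ℝ), Real.exp (-(r + ξ) ^ 2) := by
    have := (measurePreserving_add_right volume ξ).setIntegral_preimage_emb
      (measurableEmbedding_addRight ξ) (fun s => Real.exp (-s ^ 2)) (Set.Ioi ξ)
    rw [← this]
    congr 2
    simp
  have h2 : ∫ r in Set.Ioi (0 : ℝ), Real.exp (-(r + ξ) ^ 2)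
      ≤ ∫ r in Set.Ioi (0 : ℝ), Real.exp (-ξ ^ 2) * Real.exp (-r ^ 2) := by
    refine setIntegral_mono_on (integrable_exp_neg_sq.comp_add_right ξ).integrableOn
      (integrable_exp_neg_sq.const_mul _).integrableOn measurableSet_Ioi fun r hr => ?_
    rw [← Real.exp_add, Real.exp_le_exp]
    have : 0 ≤ r * ξ := mul_nonneg (le_of_lt hr) hξ
    nlinarith
  rw [integral_const_mul, integral_exp_neg_sq_Ioi] at h2
  have hpi : 0 < √Real.pi := by positivity
  calc erfc ξ ≤ 2 / √Real.pi * (Real.exp (-ξ ^ 2) * (√Real.pi / 2)) := by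
        rw [erfc, h1]; gcongr
    _ = Real.exp (-ξ ^ 2) := by field_simp

end ErrorFunction

section Excitation

variable (m : Medium)

/-- The Gaussian part of the excitation light. -/
def gaussPart (y : Point) (t : ℝ) (xs : Point) : ℝ :=
  m.D * Real.exp (-m.μA * t) / (4 * Real.pi * m.D * t) ^ (3 / 2 : ℝ)
    * Real.exp (-((y 0 - xs 0) ^ 2 + (y 1 - xs 1) ^ 2) / (4 * m.D * t))
    * Real.exp (-(y 2) ^ 2 / (4 * m.D * t))

/-- The part of the excitation light containing the error function. -/
def robinPart (y : Point) (t : ℝ) (xs : Point) : ℝ :=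
  m.D * Real.exp (-m.μA * t) / (4 * Real.pi * m.D * t) ^ (3 / 2 : ℝ)
    * Real.exp (-((y 0 - xs 0) ^ 2 + (y 1 - xs 1) ^ 2) / (4 * m.D * t))
    * (√(Real.pi * m.D * t) * Real.exp (m.β * y 2 + m.β ^ 2 * m.D * t)
        * erfc ((y 2 + 2 * m.β * m.D * t) / √(4 * m.D * t)))

theorem excitation_eq (y : Point) (t : ℝ) (xs : Point) :
    excitation m y t xs = 2 * gaussPart m y t xs - 2 * m.β * robinPart m y t xs := by
  simp only [excitation, gaussPart, robinPart]
  ring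

/-- The partial derivatives of the excitation light with respect to the space variable. -/
def excitationGrad (y : Point) (t : ℝ) (xs : Point) : Fin 3 → ℝ :=
  ![-((y 0 - xs 0) / (2 * m.D * t)) * excitation m y t xs,
    -((y 1 - xs 1) / (2 * m.D * t)) * excitation m y t xs,
    2 * (-(y 2 / (2 * m.D * t)) * gaussPart m y t xs)
      - 2 * m.β * (m.β * robinPart m y t xs - gaussPart m y t xs)]

/-- The identity behind the Robin boundary condition: the Gaussian at the argument of the error
function compensates the exponential growth. -/
theorem exp_mul_exp_robin {D t : ℝ} (hD : 0 < D) (ht : 0 < t) (β x : ℝ) :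
    Real.exp (β * x + β ^ 2 * D * t) * Real.exp (-((x + 2 * β * D * t) / √(4 * D * t)) ^ 2)
      = Real.exp (-x ^ 2 / (4 * D * t)) := by
  rw [← Real.exp_add]
  congr 1
  have hs : √(4 * D * t) ^ 2 = 4 * D * t := Real.sq_sqrt (by positivity)
  rw [div_pow, hs]
  field_simp
  ring

theorem hasDerivAt_excitation {t : ℝ} (ht : 0 < t) (xs y : Point) (d : Fin 3) (r : ℝ) :
    HasDerivAt (fun r => excitation m (Function.update y d r) t xs)
      (excitationGrad m (Function.update y d r) t xs d) r := by
  have hD := m.D_pos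
  have hid := hasDerivAt_id' r
  fin_cases d
  · have h1 : HasDerivAt (fun r => Real.exp (-((r - xs 0) ^ 2 + (y 1 - xs 1) ^ 2) / (4 * m.D * t)))
        (Real.exp (-((r - xs 0) ^ 2 + (y 1 - xs 1) ^ 2) / (4 * m.D * t)) *
          (-((r - xs 0) / (2 * m.D * t)))) r := by
      have := ((((hid.sub_const (xs 0)).pow 2).add_const ((y 1 - xs 1) ^ 2)).neg.div_const
        (4 * m.D * t)).exp
      refine this.congr_deriv ?_
      congr 1
      field_simp
      ring
    simp only [excitationGrad, excitation, Fin.zero_eta, Matrix.cons_val_zero,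
      Function.update_self, Function.update_of_ne (show (1 : Fin 3) ≠ 0 by decide),
      Function.update_of_ne (show (2 : Fin 3) ≠ 0 by decide)]
    refine ((h1.const_mul _).mul_const _).congr_deriv ?_
    ring
  · have h1 : HasDerivAt (fun r => Real.exp (-((y 0 - xs 0) ^ 2 + (r - xs 1) ^ 2) / (4 * m.D * t)))
        (Real.exp (-((y 0 - xs 0) ^ 2 + (r - xs 1) ^ 2) / (4 * m.D * t)) *
          (-((r - xs 1) / (2 * m.D * t)))) r := by
      have := ((((hid.sub_const (xs 1)).pow 2).const_add ((y 0 - xs 0) ^ 2)).neg.div_const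
        (4 * m.D * t)).exp
      refine this.congr_deriv ?_
      congr 1
      field_simp
      ring
    simp only [excitationGrad, excitation, Fin.mk_one, Matrix.cons_val_one, Matrix.cons_val_zero,
      Function.update_self, Function.update_of_ne (show (0 : Fin 3) ≠ 1 by decide),
      Function.update_of_ne (show (2 : Fin 3) ≠ 1 by decide)]
    refine ((h1.const_mul _).mul_const _).congr_deriv ?_
    ring
  · have h1 : HasDerivAt (fun r => Real.exp (-r ^ 2 / (4 * m.D * t)))
        (Real.exp (-r ^ 2 / (4 * m.D * t)) * (-(r / (2 * m.D * t)))) r := by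
      have := (((hid.pow 2)).neg.div_const (4 * m.D * t)).exp
      refine this.congr_deriv ?_
      congr 1
      field_simp
      ring
    have h2 : HasDerivAt (fun r => √(Real.pi * m.D * t) * Real.exp (m.β * r + m.β ^ 2 * m.D * t)
        * erfc ((r + 2 * m.β * m.D * t) / √(4 * m.D * t)))
        (m.β * (√(Real.pi * m.D * t) * Real.exp (m.β * r + m.β ^ 2 * m.D * t)
          * erfc ((r + 2 * m.β * m.D * t) / √(4 * m.D * t))) - Real.exp (-r ^ 2 / (4 * m.D * t)))
        r := by
      have hE := ((hid.const_mul m.β).add_const (m.β ^ 2 * m.D * t)).exp.const_mul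
        (√(Real.pi * m.D * t))
      have hξ := (hasDerivAt_erfc ((r + 2 * m.β * m.D * t) / √(4 * m.D * t))).comp r
        ((hid.add_const (2 * m.β * m.D * t)).div_const (√(4 * m.D * t)))
      refine (hE.mul hξ).congr_deriv ?_
      -- The derivative of `erfc` contributes exactly the Gaussian, since the factor `√(π D t)`
      -- cancels `2 / √π` times the inner derivative `1 / √(4 D t)`.
      rw [← exp_mul_exp_robin hD ht m.β r]
      have hs1 : √(4 * m.D * t) = 2 * √(m.D * t) := by
        rw [mul_assoc, Real.sqrt_mul (by norm_num), show (4 : ℝ) = 2 ^ 2 by norm_num,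
          Real.sqrt_sq (by norm_num)]
      have hs2 : √(Real.pi * m.D * t) = √Real.pi * √(m.D * t) := by
        rw [mul_assoc, Real.sqrt_mul Real.pi_pos.le]
      have hp1 : 0 < √(m.D * t) := Real.sqrt_pos.2 (by positivity)
      have hp2 : 0 < √Real.pi := by positivity
      rw [hs1, hs2]
      simp only [Function.comp_apply]
      field_simp
      ring
    have hfun : (fun r => excitation m (Function.update y 2 r) t xs)
        = fun r => m.D * Real.exp (-m.μA * t) / (4 * Real.pi * m.D * t) ^ (3 / 2 : ℝ)
        * Real.exp (-((y 0 - xs 0) ^ 2 + (y 1 - xs 1) ^ 2) / (4 * m.D * t))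
        * (2 * Real.exp (-r ^ 2 / (4 * m.D * t)) - 2 * m.β *
          (√(Real.pi * m.D * t) * Real.exp (m.β * r + m.β ^ 2 * m.D * t)
            * erfc ((r + 2 * m.β * m.D * t) / √(4 * m.D * t)))) := by
      funext r
      simp only [excitation, Function.update_self,
        Function.update_of_ne (show (0 : Fin 3) ≠ 2 by decide),
        Function.update_of_ne (show (1 : Fin 3) ≠ 2 by decide)]
      ring
    change HasDerivAt (fun r => excitation m (Function.update y 2 r) t xs) _ r
    rw [hfun]
    refine (((h1.const_mul 2).sub (h2.const_mul (2 * m.β))).const_mul _).congr_deriv ?_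
    simp only [excitationGrad, gaussPart, robinPart, Fin.reduceFinMk, Matrix.cons_val,
      Function.update_self, Function.update_of_ne (show (0 : Fin 3) ≠ 2 by decide),
      Function.update_of_ne (show (1 : Fin 3) ≠ 2 by decide)]
    ring

/-- The Gaussian decay of `erfc` absorbs the growing exponential by `exp_mul_exp_robin`, so bounds
near `t = 0` need only be proved for the Gaussian part. -/
theorem abs_robinPart_le {y : Point} (hy : 0 ≤ y 2) {t : ℝ} (ht : 0 < t) (xs : Point) :
    |robinPart m y t xs| ≤ √(Real.pi * m.D * t) * gaussPart m y t xs := by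
  have hD := m.D_pos
  have hβ := m.β_nonneg
  have h0 : 0 ≤ robinPart m y t xs := by
    have := erfc_nonneg ((y 2 + 2 * m.β * m.D * t) / √(4 * m.D * t))
    unfold robinPart
    positivity
  rw [abs_of_nonneg h0, robinPart, gaussPart, ← exp_mul_exp_robin hD ht m.β (y 2)]
  have h1 := erfc_le_exp (ξ := (y 2 + 2 * m.β * m.D * t) / √(4 * m.D * t)) (by positivity)
  have h2 : 0 ≤ m.D * Real.exp (-m.μA * t) / (4 * Real.pi * m.D * t) ^ (3 / 2 : ℝ)
    * Real.exp (-((y 0 - xs 0) ^ 2 + (y 1 - xs 1) ^ 2) / (4 * m.D * t)) := by positivity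
  calc _ ≤ m.D * Real.exp (-m.μA * t) / (4 * Real.pi * m.D * t) ^ (3 / 2 : ℝ)
        * Real.exp (-((y 0 - xs 0) ^ 2 + (y 1 - xs 1) ^ 2) / (4 * m.D * t))
        * (√(Real.pi * m.D * t) * Real.exp (m.β * y 2 + m.β ^ 2 * m.D * t)
        * Real.exp (-((y 2 + 2 * m.β * m.D * t) / √(4 * m.D * t)) ^ 2)) := by gcongr
    _ = _ := by ring

theorem exists_gaussPart_le {δ : ℝ} (hδ : 0 < δ) (xs : Point) {T : ℝ} (hT : 0 < T) :
    ∃ M, 0 ≤ M ∧ ∀ y : Point, δ ≤ y 2 → ∀ t, 0 < t → t ≤ T →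
      |gaussPart m y t xs| ≤ M * t := by
  have hD := m.D_pos
  refine ⟨m.D / (4 * Real.pi * m.D) ^ (3 / 2 : ℝ) * (6 * (4 * m.D / δ ^ 2) ^ 3) * √T,
    by positivity, fun y hy t ht htT => ?_⟩
  have h0 : 0 ≤ gaussPart m y t xs := by unfold gaussPart; positivity
  rw [abs_of_nonneg h0, gaussPart]
  have h1 : Real.exp (-m.μA * t) ≤ 1 := Real.exp_le_one_iff.2 (by nlinarith [m.μA_pos])
  have h2 : Real.exp (-((y 0 - xs 0) ^ 2 + (y 1 - xs 1) ^ 2) / (4 * m.D * t)) ≤ 1 :=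
    Real.exp_le_one_iff.2 (div_nonpos_of_nonpos_of_nonneg (by nlinarith) (by positivity))
  -- From `x ^ 3 / 3! ≤ exp x`. The third power outweighs the singular factor `t ^ (-3/2)` and
  -- leaves a full factor `t`, needed because the gradient contains `1 / t`.
  have h3 : Real.exp (-(y 2) ^ 2 / (4 * m.D * t)) ≤ 6 * (4 * m.D / δ ^ 2) ^ 3 * t ^ 3 := by
    have ha : 0 < δ ^ 2 / (4 * m.D * t) := by positivity
    have := Real.pow_div_factorial_le_exp _ ha.le 3
    have h4 : Real.exp (-(y 2) ^ 2 / (4 * m.D * t)) ≤ (Real.exp (δ ^ 2 / (4 * m.D * t)))⁻¹ := by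
      rw [← Real.exp_neg, Real.exp_le_exp, neg_div]
      gcongr
    refine h4.trans ((inv_anti₀ (by positivity) this).trans_eq ?_)
    simp only [Nat.factorial]
    push_cast
    field_simp
  have h5 : (4 * Real.pi * m.D * t) ^ (3 / 2 : ℝ)
      = (4 * Real.pi * m.D) ^ (3 / 2 : ℝ) * (t * √t) := by
    rw [Real.mul_rpow (by positivity) ht.le, show (3 / 2 : ℝ) = 1 + 1 / 2 by norm_num,
      Real.rpow_add ht, Real.rpow_one, Real.sqrt_eq_rpow]
  have h6 : √t ≤ √T := Real.sqrt_le_sqrt htT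
  have hs : √t * √t = t := Real.mul_self_sqrt ht.le
  have hs0 : 0 < √t := Real.sqrt_pos.2 ht
  rw [h5]
  calc _ ≤ m.D * 1 / ((4 * Real.pi * m.D) ^ (3 / 2 : ℝ) * (t * √t)) * 1
        * (6 * (4 * m.D / δ ^ 2) ^ 3 * t ^ 3) := by gcongr
    _ = m.D / (4 * Real.pi * m.D) ^ (3 / 2 : ℝ) * (6 * (4 * m.D / δ ^ 2) ^ 3) * (t ^ 2 / √t) := by
        field_simp
    _ = m.D / (4 * Real.pi * m.D) ^ (3 / 2 : ℝ) * (6 * (4 * m.D / δ ^ 2) ^ 3) * (√t * t) := by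
        congr 1
        rw [div_eq_iff hs0.ne']
        linear_combination -t * hs
    _ ≤ m.D / (4 * Real.pi * m.D) ^ (3 / 2 : ℝ) * (6 * (4 * m.D / δ ^ 2) ^ 3) * (√T * t) := by
        gcongr
    _ = _ := by ring

end Excitation

end FDOT

end

/-! ### The excitation light as an analytic curve in a space of continuous functions. -/

noncomputable section

namespace FDOT

section ContinuousFunctions

variable {K : Type*} [TopologicalSpace K] [CompactSpace K]

theorem exp_apply (f : C(K, ℝ)) (k : K) : (NormedSpace.exp f) k = Real.exp (f k) := by
  rw [Real.exp_eq_exp_ℝ]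
  exact NormedSpace.map_exp (ContinuousMap.evalAlgHom ℝ ℝ k)
    (ContinuousMap.evalCLM ℝ k : C(K, ℝ) →L[ℝ] ℝ).continuous f

theorem analyticAt_exp_smul {c : ℝ → ℝ} {t : ℝ} (hc : AnalyticAt ℝ c t) (f : C(K, ℝ)) :
    AnalyticAt ℝ (fun t => NormedSpace.exp (c t • f)) t :=
  (NormedSpace.exp_analytic (𝕂 := ℝ) (c t • f)).comp_of_eq
    (f := fun t => c t • f) (hc.fun_smul analyticAt_const) rfl

/-- The complementary error function acting on continuous functions. -/
def erfcMap (f : C(K, ℝ)) : C(K, ℝ) := ⟨fun k => erfc (f k), continuous_erfc.comp f.continuous⟩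

/-- This expresses `erfc` through the exponential of the Banach algebra `C(K, ℝ)` and an integral
over a fixed interval, so its analyticity reduces to that of `exp`. -/
theorem erfcMap_eq (f : C(K, ℝ)) : erfcMap f = 1 - (2 / √Real.pi) •
    (f * ∫ θ in (0 : ℝ)..1, NormedSpace.exp ((-θ ^ 2) • f ^ 2)) := by
  have hcont : Continuous fun θ : ℝ => NormedSpace.exp ((-θ ^ 2) • f ^ 2) :=
    continuous_iff_continuousAt.2 fun θ =>
      (analyticAt_exp_smul (analyticAt_id.pow 2).neg (f ^ 2)).continuousAt
  ext k
  have h := (ContinuousMap.evalCLM ℝ k : C(K, ℝ) →L[ℝ] ℝ).intervalIntegral_comp_comm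
    (hcont.intervalIntegrable (μ := volume) 0 1)
  simp only [ContinuousMap.evalCLM_apply, exp_apply] at h
  simp only [erfcMap, ContinuousMap.coe_mk, ContinuousMap.sub_apply, ContinuousMap.one_apply,
    ContinuousMap.smul_apply, ContinuousMap.mul_apply, smul_eq_mul]
  rw [← h, erfc_eq_integral]
  simp

theorem analyticAt_erfcMap {f : ℝ → C(K, ℝ)} {t : ℝ} (hf : AnalyticAt ℝ f t) :
    AnalyticAt ℝ (fun t => erfcMap (f t)) t := by
  simp only [erfcMap_eq]
  refine analyticAt_const.sub (AnalyticAt.fun_smul analyticAt_const (hf.fun_mul ?_))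
  have h := analyticAt_weighted_integral (ContinuousLinearMap.lsmul ℝ ℝ).flip
    (H := fun z : ℝ × ℝ => NormedSpace.exp ((-z.2 ^ 2) • f z.1 ^ 2)) (g := fun _ => (1 : ℝ))
    (t₀ := t) zero_le_one (fun s _ => ?_) (by simp)
  · simpa using h
  · refine (NormedSpace.exp_analytic (𝕂 := ℝ) _).comp ?_
    exact (analyticAt_snd.pow 2).neg.smul ((hf.comp_of_eq analyticAt_fst rfl).pow 2)

end ContinuousFunctions

theorem analyticAt_const_mul_rpow {a t : ℝ} (ha : 0 < a) (ht : 0 < t) (p : ℝ) :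
    AnalyticAt ℝ (fun t => (a * t) ^ p) t := by
  have h : AnalyticAt ℝ (fun t => Real.exp (Real.log (a * t) * p)) t := by
    have h1 : AnalyticAt ℝ (fun t => a * t) t := analyticAt_const.mul analyticAt_id
    exact (((analyticAt_log (mul_pos ha ht)).comp_of_eq h1 rfl).mul analyticAt_const).rexp
  refine h.congr ?_
  filter_upwards [lt_mem_nhds ht] with s hs
  rw [Real.rpow_def_of_pos (mul_pos ha hs)]

theorem analyticAt_sqrt_const_mul {a t : ℝ} (ha : 0 < a) (ht : 0 < t) :
    AnalyticAt ℝ (fun t => √(a * t)) t := by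
  simpa [Real.sqrt_eq_rpow] using analyticAt_const_mul_rpow ha ht (1 / 2)

section Excitation

variable (m : Medium) {K : Type*} [TopologicalSpace K] (pt : C(K, Point))
  (xs : Point)

/-- The coordinate functions of a map into the space. -/
def coordMap (d : Fin 3) : C(K, ℝ) := ⟨fun k => pt k d, by fun_prop⟩

/-- The Gaussian part of the excitation light as a function on a compact set. -/
def gaussMap (t : ℝ) : C(K, ℝ) := ⟨fun k => gaussPart m (pt k) t xs, by
  unfold gaussPart; fun_prop⟩

/-- The error function part of the excitation light as a function on a compact set. -/
def robinMap (t : ℝ) : C(K, ℝ) := ⟨fun k => robinPart m (pt k) t xs, by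
  have := continuous_erfc
  unfold robinPart; fun_prop⟩

/-- The excitation light as a function on a compact set. -/
def excitationMap (t : ℝ) : C(K, ℝ) :=
  (2 : ℝ) • gaussMap m pt xs t - (2 * m.β) • robinMap m pt xs t

theorem excitationMap_apply (t : ℝ) (k : K) :
    excitationMap m pt xs t k = excitation m (pt k) t xs := by
  rw [excitation_eq]; rfl

/-- The partial derivatives of the excitation light as functions on a compact set. -/
def excitationGradMap (t : ℝ) : Fin 3 → C(K, ℝ) :=
  ![(-(2 * m.D)⁻¹) • ((coordMap pt 0 - ContinuousMap.const K (xs 0)) *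
      t⁻¹ • excitationMap m pt xs t),
    (-(2 * m.D)⁻¹) • ((coordMap pt 1 - ContinuousMap.const K (xs 1)) *
      t⁻¹ • excitationMap m pt xs t),
    (2 * -(2 * m.D)⁻¹) • (coordMap pt 2 * t⁻¹ • gaussMap m pt xs t)
      - (2 * m.β) • (m.β • robinMap m pt xs t - gaussMap m pt xs t)]

theorem excitationGradMap_apply (t : ℝ) (d : Fin 3) (k : K) :
    excitationGradMap m pt xs t d k = excitationGrad m (pt k) t xs d := by
  fin_cases d
  · simp [excitationGradMap, excitationGrad, excitationMap_apply, coordMap]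
    ring
  · simp [excitationGradMap, excitationGrad, excitationMap_apply, coordMap]
    ring
  · simp [excitationGradMap, excitationGrad, gaussMap, robinMap, coordMap]
    ring

variable [CompactSpace K]

theorem analyticAt_prefactor {t : ℝ} (ht : 0 < t) : AnalyticAt ℝ (fun t =>
    m.D * Real.exp (-m.μA * t) / (4 * Real.pi * m.D * t) ^ (3 / 2 : ℝ)) t := by
  have hD := m.D_pos
  have h1 : AnalyticAt ℝ (fun t => -m.μA * t) t := analyticAt_const.mul analyticAt_id
  exact (analyticAt_const.mul h1.rexp).div
    (analyticAt_const_mul_rpow (by positivity) ht _) (by positivity)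

/-- Analyticity is in the sup norm, hence uniform in space: the map is an analytic scalar times a
Banach algebra exponential of a scalar multiple of a fixed element. -/
theorem analyticAt_gaussMap {t : ℝ} (ht : 0 < t) : AnalyticAt ℝ (gaussMap m pt xs) t := by
  have hD := m.D_pos
  have h : AnalyticAt ℝ (fun t => (m.D * Real.exp (-m.μA * t) /
      (4 * Real.pi * m.D * t) ^ (3 / 2 : ℝ)) • NormedSpace.exp ((-(4 * m.D * t)⁻¹) •
        ((coordMap pt 0 - ContinuousMap.const K (xs 0)) ^ 2
          + (coordMap pt 1 - ContinuousMap.const K (xs 1)) ^ 2 + coordMap pt 2 ^ 2))) t := by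
    refine (analyticAt_prefactor m ht).smul (analyticAt_exp_smul ?_ _)
    exact ((analyticAt_const.mul analyticAt_id).inv (by simp [hD.ne', ht.ne'])).neg
  convert h using 1
  funext t
  ext k
  simp only [gaussMap, gaussPart, ContinuousMap.coe_mk, ContinuousMap.smul_apply, exp_apply,
    ContinuousMap.add_apply, ContinuousMap.pow_apply, ContinuousMap.sub_apply,
    ContinuousMap.const_apply, coordMap, smul_eq_mul]
  rw [mul_assoc, ← Real.exp_add]
  congr 2
  ring

theorem analyticAt_robinMap {t : ℝ} (ht : 0 < t) : AnalyticAt ℝ (robinMap m pt xs) t := by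
  have hD := m.D_pos
  have hlin : AnalyticAt ℝ (fun t : ℝ => t) t := analyticAt_id
  have h : AnalyticAt ℝ (fun t => (m.D * Real.exp (-m.μA * t) /
      (4 * Real.pi * m.D * t) ^ (3 / 2 : ℝ)) • ((NormedSpace.exp ((-(4 * m.D * t)⁻¹) •
        ((coordMap pt 0 - ContinuousMap.const K (xs 0)) ^ 2
          + (coordMap pt 1 - ContinuousMap.const K (xs 1)) ^ 2))) *
        (√(Real.pi * m.D * t) • (NormedSpace.exp (m.β • coordMap pt 2
          + (m.β ^ 2 * m.D * t) • (1 : C(K, ℝ)))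
          * erfcMap ((√(4 * m.D * t))⁻¹ • (coordMap pt 2
            + (2 * m.β * m.D * t) • (1 : C(K, ℝ)))))))) t := by
    refine (analyticAt_prefactor m ht).fun_smul (AnalyticAt.fun_mul (analyticAt_exp_smul ?_ _)
      (AnalyticAt.fun_smul ?_ (AnalyticAt.fun_mul ?_ (analyticAt_erfcMap
        (AnalyticAt.fun_smul ?_ ?_)))))
    · exact ((analyticAt_const.mul analyticAt_id).inv (by simp [hD.ne', ht.ne'])).neg
    · exact analyticAt_sqrt_const_mul (by positivity) ht
    · refine (NormedSpace.exp_analytic (𝕂 := ℝ) _).comp ?_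
      exact analyticAt_const.add ((analyticAt_const.mul hlin).smul analyticAt_const)
    · exact (analyticAt_sqrt_const_mul (by positivity) ht).inv (by positivity)
    · exact analyticAt_const.add ((analyticAt_const.mul hlin).smul analyticAt_const)
  convert h using 1
  funext t
  ext k
  simp only [robinMap, robinPart, ContinuousMap.coe_mk, ContinuousMap.smul_apply, exp_apply,
    ContinuousMap.add_apply, ContinuousMap.pow_apply, ContinuousMap.sub_apply,
    ContinuousMap.mul_apply, ContinuousMap.one_apply, erfcMap,
    ContinuousMap.const_apply, coordMap, smul_eq_mul, mul_one]
  rw [mul_assoc]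
  congr 2
  · congr 1
    ring
  · rw [div_eq_inv_mul]
    ring

variable {pt} {δ : ℝ} (hδ : 0 < δ) (hpt : ∀ k, δ ≤ pt k 2)
include hδ hpt

/-- The factor `t⁻¹` occurs in the spatial gradient. It is harmless since all points have height at
least `δ`, where the Gaussian is `O(t)`. -/
theorem analyticBounded_inv_smul_gaussMap :
    AnalyticBounded fun t : ℝ => t⁻¹ • gaussMap m pt xs t := by
  refine ⟨fun t ht => (analyticAt_inv (ne_of_gt ht)).smul (analyticAt_gaussMap m pt xs ht),
    fun T hT => ?_⟩
  obtain ⟨M, hM0, hM⟩ := exists_gaussPart_le m hδ xs hT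
  refine ⟨M, fun t ht htT => (ContinuousMap.norm_le _ hM0).2 fun k => ?_⟩
  have := hM (pt k) (hpt k) t ht htT
  rw [ContinuousMap.smul_apply, norm_smul, norm_inv, Real.norm_of_nonneg ht.le,
    inv_mul_le_iff₀ ht, mul_comm]
  exact this

theorem analyticBounded_inv_smul_robinMap :
    AnalyticBounded fun t : ℝ => t⁻¹ • robinMap m pt xs t := by
  refine ⟨fun t ht => (analyticAt_inv (ne_of_gt ht)).smul (analyticAt_robinMap m pt xs ht),
    fun T hT => ?_⟩
  have hD := m.D_pos
  obtain ⟨M, hM0, hM⟩ := exists_gaussPart_le m hδ xs hT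
  refine ⟨√(Real.pi * m.D * T) * M, fun t ht htT =>
    (ContinuousMap.norm_le _ (by positivity)).2 fun k => ?_⟩
  have h1 := (le_abs_self _).trans (hM (pt k) (hpt k) t ht htT)
  have h2 := abs_robinPart_le m (hδ.le.trans (hpt k)) ht xs
  rw [ContinuousMap.smul_apply, norm_smul, norm_inv, Real.norm_of_nonneg ht.le,
    inv_mul_le_iff₀ ht]
  calc _ ≤ √(Real.pi * m.D * t) * gaussPart m (pt k) t xs := h2
    _ ≤ √(Real.pi * m.D * t) * (M * t) := by gcongr
    _ ≤ √(Real.pi * m.D * T) * (M * t) := by gcongr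
    _ = _ := by ring

end Excitation

end FDOT

theorem AnalyticBounded.of_inv_smul {X : Type*} [NormedAddCommGroup X] [NormedSpace ℝ X]
    {f : ℝ → X} (hf : AnalyticBounded fun t : ℝ => t⁻¹ • f t) : AnalyticBounded f := by
  have h := AnalyticBounded.bilin (ContinuousLinearMap.lsmul ℝ ℝ)
    (AnalyticBounded.of_analytic (f := fun t : ℝ => t) fun _ => analyticAt_id) hf
  have he : ∀ t : ℝ, 0 < t → ContinuousLinearMap.lsmul ℝ ℝ t (t⁻¹ • f t) = f t :=
    fun t ht => by simp [smul_smul, ht.ne']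
  refine ⟨fun t ht => (h.analytic t ht).congr ?_, fun T hT => ?_⟩
  · filter_upwards [lt_mem_nhds ht] with s hs using he s hs
  · obtain ⟨M, hM⟩ := h.bounded T hT
    exact ⟨M, fun t h0 h1 => by simpa only [he t h0] using hM t h0 h1⟩

namespace FDOT

section Excitation

variable (m : Medium) {K : Type*} [TopologicalSpace K] [CompactSpace K] {pt : C(K, Point)}
  (xs : Point) {δ : ℝ} (hδ : 0 < δ) (hpt : ∀ k, δ ≤ pt k 2)
include hδ hpt

theorem analyticBounded_inv_smul_excitationMap :
    AnalyticBounded fun t : ℝ => t⁻¹ • excitationMap m pt xs t := by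
  have h1 := (analyticBounded_inv_smul_gaussMap m xs hδ hpt).const_smul 2
  have h2 := (analyticBounded_inv_smul_robinMap m xs hδ hpt).const_smul (-(2 * m.β))
  convert h1.add h2 using 2 with t
  simp only [excitationMap]
  module

theorem analyticBounded_excitationMap : AnalyticBounded (excitationMap m pt xs) :=
  (analyticBounded_inv_smul_excitationMap m xs hδ hpt).of_inv_smul

theorem analyticBounded_excitationGradMap (d : Fin 3) :
    AnalyticBounded fun t => excitationGradMap m pt xs t d := by
  have hE := analyticBounded_inv_smul_excitationMap m xs hδ hpt
  have hg' := analyticBounded_inv_smul_gaussMap m xs hδ hpt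
  have hr := (analyticBounded_inv_smul_robinMap m xs hδ hpt).of_inv_smul
  fin_cases d
  · exact (hE.clm_comp (ContinuousLinearMap.mul ℝ C(K, ℝ) _)).const_smul _
  · exact (hE.clm_comp (ContinuousLinearMap.mul ℝ C(K, ℝ) _)).const_smul _
  · have h1 := (hg'.clm_comp (ContinuousLinearMap.mul ℝ C(K, ℝ) (coordMap pt 2))).const_smul
      (2 * -(2 * m.D)⁻¹)
    have h2 := ((hr.const_smul m.β).add (hg'.of_inv_smul.const_smul (-1))).const_smul
      (-(2 * m.β))
    convert h1.add h2 using 2 with t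
    simp only [excitationGradMap, Fin.reduceFinMk, Matrix.cons_val,
      ContinuousLinearMap.mul_apply']
    module

end Excitation

end FDOT

end

/-! ### Measurement kernels, jets and the fundamental theorem of calculus on boxes. -/

noncomputable section

namespace FDOT

section MeasurementKernel

variable {X : Type*} [NormedAddCommGroup X] [NormedSpace ℝ X]

/-- The time dependence of the emission light: the convolution of the propagation `f` to the
detector with the source produced with lifetime `τ` by the excitation `g`. -/
def lifetimeKernel (m : Medium) (τ : ℝ) (B : X →L[ℝ] X →L[ℝ] X) (f g : ℝ → X) : ℝ → X :=
  timeConv B f (if τ = 0 then fun s => m.cf • g s else fun s => (m.cf / τ) •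
    timeConv (ContinuousLinearMap.lsmul ℝ ℝ) (fun r => Real.exp (-r / τ)) g s)

/-- The time dependence of the measured quantity. -/
def measurementKernel (m : Medium) (B : X →L[ℝ] X →L[ℝ] X) (f g : ℝ → X) :
    Measurement → ℝ → X
  | .zeroLifetime => lifetimeKernel m 0 B f g
  | .detected q τ _ =>
    timeConv (ContinuousLinearMap.lsmul ℝ ℝ).flip (lifetimeKernel m τ B f g) q.q

theorem Response.analyticIntegrable (q : Response) : AnalyticIntegrable q.q :=
  ⟨q.analytic, q.integrable⟩

variable [CompleteSpace X] (m : Medium) (B : X →L[ℝ] X →L[ℝ] X) {f g : ℝ → X}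

theorem analyticBounded_exp_div (τ : ℝ) : AnalyticBounded fun r : ℝ => Real.exp (-r / τ) :=
  .of_analytic fun t => by
    have : AnalyticAt ℝ (fun r : ℝ => -r / τ) t := by
      simp only [div_eq_mul_inv]
      exact analyticAt_id.neg.mul analyticAt_const
    exact this.rexp'

theorem analyticBounded_source (hg : AnalyticBounded g) (τ : ℝ) :
    AnalyticBounded (if τ = 0 then fun s => m.cf • g s else fun s => (m.cf / τ) •
      timeConv (ContinuousLinearMap.lsmul ℝ ℝ) (fun r => Real.exp (-r / τ)) g s) := by
  split_ifs
  · exact hg.const_smul _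
  · exact ((analyticBounded_exp_div τ).timeConv _ hg).const_smul _

theorem analyticBounded_lifetimeKernel (hf : AnalyticBounded f) (hg : AnalyticBounded g) (τ : ℝ) :
    AnalyticBounded (lifetimeKernel m τ B f g) :=
  hf.timeConv B (analyticBounded_source m hg τ)

theorem analyticOnNhd_measurementKernel (hf : AnalyticBounded f) (hg : AnalyticBounded g)
    (u : Measurement) : AnalyticOnNhd ℝ (measurementKernel m B f g u) (Set.Ioi 0) := by
  cases u with
  | zeroLifetime => exact (analyticBounded_lifetimeKernel m B hf hg 0).analytic
  | detected q τ hτ =>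
    exact timeConv_analytic _ (analyticBounded_lifetimeKernel m B hf hg τ) q.analyticIntegrable

section Kernel

variable {ι : Type*} {Λ : ι → X →L[ℝ] ℝ}

/-- A continuous functional passes under the integral, and the end points of the time interval are
negligible. -/
theorem timeConv_mem_ker {Y : Type*} [NormedAddCommGroup Y] [NormedSpace ℝ Y] {Z : Type*}
    [NormedAddCommGroup Z] [NormedSpace ℝ Z] {B : Y →L[ℝ] Z →L[ℝ] X} {f : ℝ → Y} {g : ℝ → Z}
    (hf : AnalyticBounded f) (hg : AnalyticIntegrable g) {t : ℝ} (ht : 0 < t)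
    (h : ∀ s, 0 < s → s < t → ∀ i, Λ i (B (f (t - s)) (g s)) = 0) (i : ι) :
    Λ i (timeConv B f g t) = 0 := by
  rw [clm_timeConv B hf hg _ ht, intervalIntegral.integral_of_le ht.le,
    integral_Ioc_eq_integral_Ioo, setIntegral_congr_fun (g := fun _ => (0 : ℝ)) measurableSet_Ioo]
  · simp
  · exact fun s hs => h s hs.1 hs.2 i

/-- The kernel of the measured quantity takes values in every closed subalgebra in which the
propagations to the detector and from the source take values. -/
theorem measurementKernel_mem_ker
    (hB : ∀ x y, (∀ i, Λ i x = 0) → (∀ i, Λ i y = 0) → ∀ i, Λ i (B x y) = 0)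
    (hf : AnalyticBounded f) (hg : AnalyticBounded g) (hf0 : ∀ t, 0 < t → ∀ i, Λ i (f t) = 0)
    (hg0 : ∀ t, 0 < t → ∀ i, Λ i (g t) = 0) (u : Measurement) {t : ℝ} (ht : 0 < t) (i : ι) :
    Λ i (measurementKernel m B f g u t) = 0 := by
  have hlife : ∀ τ t, 0 < t → ∀ i, Λ i (lifetimeKernel m τ B f g t) = 0 := by
    intro τ t ht
    refine timeConv_mem_ker hf (analyticBounded_source m hg τ).analyticIntegrable ht
      fun s hs hst => hB _ _ (hf0 _ (sub_pos.2 hst)) fun i => ?_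
    split_ifs
    · simp [hg0 s hs i]
    · rw [map_smul, timeConv_mem_ker (analyticBounded_exp_div τ) hg.analyticIntegrable hs
        (fun r hr hrs i => by simp [hg0 r hr i]), smul_zero]
  cases u with
  | zeroLifetime => exact hlife 0 t ht i
  | detected q τ hτ =>
    exact timeConv_mem_ker (analyticBounded_lifetimeKernel m B hf hg τ) q.analyticIntegrable ht
      (fun s hs hst i => by simp [hlife τ _ (sub_pos.2 hst) i]) i

end Kernel

end MeasurementKernel

section Jets

/-- Two continuous functions `f` and `f'`, the latter with three components: a candidate for a
function together with its partial derivatives. -/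
abbrev Jet (K : Type*) [TopologicalSpace K] := C(K, ℝ) × (Fin 3 → C(K, ℝ))

variable {K : Type*} [TopologicalSpace K] [CompactSpace K]

/-- The product of functions with partial derivatives, by the Leibniz rule. -/
def leibniz (K : Type*) [TopologicalSpace K] [CompactSpace K] :
    Jet K →L[ℝ] Jet K →L[ℝ] Jet K :=
  LinearMap.mkContinuous₂
    (LinearMap.mk₂ ℝ (fun x y : Jet K => (x.1 * y.1, fun d => x.1 * y.2 d + x.2 d * y.1))
      (fun x x' y => by
        refine Prod.ext (by simp [add_mul]) (funext fun d => ?_)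
        simp only [Prod.fst_add, Prod.snd_add, Pi.add_apply, add_mul]; abel)
      (fun c x y => by
        refine Prod.ext (by simp) (funext fun d => ?_)
        simp [smul_add])
      (fun x y y' => by
        refine Prod.ext (by simp [mul_add]) (funext fun d => ?_)
        simp only [Prod.fst_add, Prod.snd_add, Pi.add_apply, mul_add]; abel)
      (fun c x y => by
        refine Prod.ext (by simp) (funext fun d => ?_)
        simp [smul_add]))
    2 (fun x y => by
      have h1 : ‖x.1‖ ≤ ‖x‖ := norm_fst_le x
      have h2 : ‖y.1‖ ≤ ‖y‖ := norm_fst_le y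
      have h3 : ∀ d, ‖x.2 d‖ ≤ ‖x‖ := fun d => (norm_le_pi_norm x.2 d).trans (norm_snd_le x)
      have h4 : ∀ d, ‖y.2 d‖ ≤ ‖y‖ := fun d => (norm_le_pi_norm y.2 d).trans (norm_snd_le y)
      have h5 : 0 ≤ ‖x‖ * ‖y‖ := by positivity
      refine max_le ?_ ((pi_norm_le_iff_of_nonneg (by positivity)).2 fun d => ?_)
      · have h6 : ‖x.1‖ * ‖y.1‖ ≤ ‖x‖ * ‖y‖ := by gcongr
        exact (norm_mul_le _ _).trans (by linarith)
      · have h6 : ‖x.1‖ * ‖y.2 d‖ ≤ ‖x‖ * ‖y‖ := by gcongr; exact h4 d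
        have h7 : ‖x.2 d‖ * ‖y.1‖ ≤ ‖x‖ * ‖y‖ := by gcongr; exact h3 d
        refine (norm_add_le _ _).trans ?_
        linarith [norm_mul_le x.1 (y.2 d), norm_mul_le (x.2 d) y.1])

@[simp] theorem leibniz_apply_fst (x y : Jet K) : (leibniz K x y).1 = x.1 * y.1 := rfl

@[simp] theorem leibniz_apply_snd (x y : Jet K) (d : Fin 3) :
    (leibniz K x y).2 d = x.1 * y.2 d + x.2 d * y.1 := rfl

/-- Integration of a continuous function along a path. -/
def pathIntegral (c : C(ℝ, K)) (a b : ℝ) : C(K, ℝ) →L[ℝ] ℝ :=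
  LinearMap.mkContinuous
    { toFun := fun f => ∫ s in a..b, f (c s)
      map_add' := fun f g => intervalIntegral.integral_add
        ((f.comp c).continuous.intervalIntegrable _ _)
        ((g.comp c).continuous.intervalIntegrable _ _)
      map_smul' := fun r f => intervalIntegral.integral_const_mul _ _ }
    |b - a| fun f => by
      rw [mul_comm]
      exact intervalIntegral.norm_integral_le_of_norm_le_const fun s _ => f.norm_coe_le_norm _

theorem pathIntegral_apply (c : C(ℝ, K)) (a b : ℝ) (f : C(K, ℝ)) :
    pathIntegral c a b f = ∫ s in a..b, f (c s) := rfl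

end Jets

/-- A nonempty compact box in the space. -/
structure Box where
  lo : Fin 3 → ℝ
  hi : Fin 3 → ℝ
  le : ∀ i, lo i ≤ hi i

namespace Box

variable (b : Box)

/-- The points of a box, as a compact space. -/
abbrev Carrier := ∀ i, Set.Icc (b.lo i) (b.hi i)

/-- The nearest point of a box. -/
def clamp : C(Point, b.Carrier) :=
  ⟨fun y i => Set.projIcc (b.lo i) (b.hi i) (b.le i) (y i), by fun_prop⟩

/-- The inclusion of a box in the space. -/
def incl : C(b.Carrier, Point) := ⟨fun k i => k i, by fun_prop⟩

/-- The points of a box, as a set. -/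
def toSet : Set Point := {y | ∀ i, y i ∈ Set.Icc (b.lo i) (b.hi i)}

variable {b}

theorem incl_clamp {y : Point} (hy : y ∈ b.toSet) : b.incl (b.clamp y) = y := by
  funext i
  simp [incl, clamp, Set.projIcc_of_mem _ (hy i)]

theorem update_mem {y : Point} (hy : y ∈ b.toSet) {d : Fin 3} {r : ℝ}
    (hr : r ∈ Set.Icc (b.lo d) (b.hi d)) : Function.update y d r ∈ b.toSet := by
  intro i
  by_cases h : i = d
  · subst h; simpa using hr
  · simpa [h] using hy i

variable (b)

/-- The line in direction `d` through a point, projected to the box. -/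
def line (d : Fin 3) (y : Point) : C(ℝ, b.Carrier) :=
  b.clamp.comp ⟨fun s => Function.update y d s, by fun_prop⟩

theorem line_apply (d : Fin 3) (y : Point) (s : ℝ) :
    b.line d y s = b.clamp (Function.update y d s) := rfl

theorem line_update (d : Fin 3) (y : Point) (r : ℝ) :
    b.line d (Function.update y d r) = b.line d y := by
  ext s; simp [line]

/-- The defect of the fundamental theorem of calculus in direction `d`. -/
def defect (i : Fin 3 × b.toSet) : Jet b.Carrier →L[ℝ] ℝ :=
  (ContinuousMap.evalCLM ℝ (b.clamp i.2) - ContinuousMap.evalCLM ℝ (b.line i.1 i.2 (b.lo i.1)))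
      ∘L ContinuousLinearMap.fst ℝ _ _
    - pathIntegral (b.line i.1 i.2) (b.lo i.1) (i.2.1 i.1) ∘L ContinuousLinearMap.proj i.1
      ∘L ContinuousLinearMap.snd ℝ _ _

theorem defect_eq_zero_iff (d : Fin 3) (y : b.toSet) (x : Jet b.Carrier) :
    b.defect (d, y) x = 0 ↔
      x.1 (b.clamp y) = x.1 (b.line d y (b.lo d)) + ∫ s in b.lo d..y.1 d, x.2 d (b.line d y s) := by
  simp only [defect, sub_apply, ContinuousLinearMap.comp_apply,
    ContinuousMap.evalCLM_apply, pathIntegral_apply, ContinuousLinearMap.coe_fst',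
    ContinuousLinearMap.coe_snd', ContinuousLinearMap.proj_apply]
  constructor <;> intro h <;> linarith

/-- Along each coordinate line, zero defect says that the function component is a primitive of the
derivative component. The assertion is then the integrated product rule. -/
theorem defect_leibniz {x x' : Jet b.Carrier} (hx : ∀ i, b.defect i x = 0)
    (hx' : ∀ i, b.defect i x' = 0) (i : Fin 3 × b.toSet) :
    b.defect i (leibniz _ x x') = 0 := by
  obtain ⟨d, y⟩ := i
  rw [defect_eq_zero_iff]
  set c := b.line d y with hc
  have hprim : ∀ z : Jet b.Carrier, (∀ i, b.defect i z = 0) → ∀ s ∈ Set.Icc (b.lo d) (b.hi d),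
      z.1 (c s) = z.1 (c (b.lo d)) + ∫ r in b.lo d..s, z.2 d (c r) := by
    intro z hz s hs
    have := (b.defect_eq_zero_iff d ⟨_, update_mem y.2 hs⟩ z).1 (hz _)
    simpa only [line_update, Function.update_self, ← line_apply, ← hc] using this
  have hcy : b.clamp y = c (y.1 d) := by
    simp [hc, line_apply]
  have hyd : y.1 d ∈ Set.Icc (b.lo d) (b.hi d) := y.2 d
  have hder : ∀ z : Jet b.Carrier, ∀ s, HasDerivAt
      (fun s => z.1 (c (b.lo d)) + ∫ r in b.lo d..s, z.2 d (c r)) (z.2 d (c s)) s := fun z s =>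
    ((((z.2 d).comp c).continuous.integral_hasStrictDerivAt _ s).hasDerivAt).const_add _
  have hftc := intervalIntegral.integral_deriv_mul_eq_sub (a := b.lo d) (b := y.1 d)
    (fun s _ => hder x s) (fun s _ => hder x' s)
    (((x.2 d).comp c).continuous.intervalIntegrable _ _)
    (((x'.2 d).comp c).continuous.intervalIntegrable _ _)
  rw [hcy]
  simp only [leibniz_apply_fst, leibniz_apply_snd, ContinuousMap.mul_apply,
    ContinuousMap.add_apply]
  rw [intervalIntegral.integral_congr (g := fun s =>
    x.2 d (c s) * (x'.1 (c (b.lo d)) + ∫ r in b.lo d..s, x'.2 d (c r)) +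
      (x.1 (c (b.lo d)) + ∫ r in b.lo d..s, x.2 d (c r)) * x'.2 d (c s)), hftc,
    hprim x hx _ hyd, hprim x' hx' _ hyd]
  · simp
  · intro s hs
    rw [Set.uIcc_of_le hyd.1] at hs
    have hs' : s ∈ Set.Icc (b.lo d) (b.hi d) := ⟨hs.1, hs.2.trans hyd.2⟩
    simp only
    rw [← hprim x hx s hs', ← hprim x' hx' s hs']
    ring

end Box

section ExcitationJet

variable (m : Medium) {K : Type*} [TopologicalSpace K]

/-- The excitation light with its partial derivatives. -/
def excitationJet (pt : C(K, Point)) (xs : Point) (t : ℝ) : Jet K :=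
  (excitationMap m pt xs t, excitationGradMap m pt xs t)

theorem analyticBounded_excitationJet [CompactSpace K] {pt : C(K, Point)} (xs : Point) {δ : ℝ}
    (hδ : 0 < δ) (hpt : ∀ k, δ ≤ pt k 2) : AnalyticBounded (excitationJet m pt xs) :=
  (analyticBounded_excitationMap m xs hδ hpt).prodMk
    (AnalyticBounded.pi fun d => analyticBounded_excitationGradMap m xs hδ hpt d)

theorem defect_excitationJet (b : Box) (xs : Point) {t : ℝ} (ht : 0 < t)
    (i : Fin 3 × b.toSet) : b.defect i (excitationJet m b.incl xs t) = 0 := by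
  obtain ⟨d, y⟩ := i
  rw [Box.defect_eq_zero_iff]
  have hyd : y.1 d ∈ Set.Icc (b.lo d) (b.hi d) := y.2 d
  have hline : ∀ s ∈ Set.Icc (b.lo d) (b.hi d), b.incl (b.line d y s) = Function.update y.1 d s :=
    fun s hs => Box.incl_clamp (Box.update_mem y.2 hs)
  have hcongr : ∀ s ∈ Set.uIcc (b.lo d) (y.1 d),
      excitationGradMap m b.incl xs t d (b.line d y s)
        = excitationGrad m (Function.update y.1 d s) t xs d := by
    intro s hs
    rw [Set.uIcc_of_le hyd.1] at hs
    rw [excitationGradMap_apply, hline s ⟨hs.1, hs.2.trans hyd.2⟩]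
  have hftc := intervalIntegral.integral_eq_sub_of_hasDerivAt (a := b.lo d) (b := y.1 d)
    (fun s _ => hasDerivAt_excitation m ht xs y.1 d s)
    ((((excitationGradMap m b.incl xs t d).comp (b.line d y)).continuous.intervalIntegrable
      _ _).congr fun s hs => hcongr s (Set.uIoc_subset_uIcc hs))
  simp only [excitationJet]
  rw [intervalIntegral.integral_congr hcongr, hftc, excitationMap_apply, excitationMap_apply,
    Box.incl_clamp y.2, hline _ ⟨le_rfl, b.le d⟩]
  simp

end ExcitationJet

end FDOT
end

/-! ### Differentiation and comparison of integrals with moving end points. -/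

section LeibnizRule

open Topology

variable {E : Type*} [NormedAddCommGroup E] [NormedSpace ℝ E] [ProperSpace E]

/-- In a proper space the closed unit ball around `e₀` is compact, so the continuous `ψ'` is bounded
there and a constant dominates. -/
theorem hasFDerivAt_intervalIntegral_param {ψ : E → ℝ → ℝ} {ψ' : E → ℝ → E →L[ℝ] ℝ}
    (hψ : Continuous ↿ψ) (hψ' : Continuous ↿ψ')
    (hder : ∀ e y, HasFDerivAt (fun e => ψ e y) (ψ' e y) e) (a b : ℝ) (e₀ : E) :
    HasFDerivAt (fun e => ∫ y in a..b, ψ e y) (∫ y in a..b, ψ' e₀ y) e₀ := by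
  have hc1 : ∀ e, Continuous (ψ e) := fun e => hψ.comp (Continuous.prodMk_right e)
  have hc2 : ∀ e, Continuous (ψ' e) := fun e => hψ'.comp (Continuous.prodMk_right e)
  obtain ⟨C, hC⟩ := ((isCompact_closedBall e₀ 1).prod
    (isCompact_uIcc (a := a) (b := b))).exists_bound_of_continuousOn hψ'.continuousOn
  refine (intervalIntegral.hasFDerivAt_integral_of_dominated_of_fderiv_le (μ := volume)
    (F := ψ) (F' := ψ') (bound := fun _ => C) (Metric.closedBall_mem_nhds e₀ one_pos) ?_
    ((hc1 e₀).intervalIntegrable _ _) (hc2 e₀).aestronglyMeasurable ?_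
    intervalIntegrable_const ?_)
  · exact Filter.Eventually.of_forall fun e => (hc1 e).aestronglyMeasurable
  · exact Filter.Eventually.of_forall fun y hy e he =>
      hC (e, y) ⟨he, Set.uIoc_subset_uIcc hy⟩
  · exact Filter.Eventually.of_forall fun y _ e _ => hder e y

/-- The Leibniz rule for an integral over an interval whose integrand and end points depend on a
parameter. -/
theorem hasFDerivAt_intervalIntegral_endpoints {ψ : E → ℝ → ℝ} {ψ' : E → ℝ → E →L[ℝ] ℝ}
    (hψ : Continuous ↿ψ) (hψ' : Continuous ↿ψ')
    (hder : ∀ e y, HasFDerivAt (fun e => ψ e y) (ψ' e y) e) (u v : E →L[ℝ] ℝ) (e₀ : E) :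
    HasFDerivAt (fun e => ∫ y in u e..v e, ψ e y)
      ((∫ y in u e₀..v e₀, ψ' e₀ y) + ψ e₀ (v e₀) • v - ψ e₀ (u e₀) • u) e₀ := by
  have hc1 : ∀ e, Continuous (ψ e) := fun e => hψ.comp (Continuous.prodMk_right e)
  have hc2 : ∀ e, Continuous (ψ' e) := fun e => hψ'.comp (Continuous.prodMk_right e)
  let f : E → ℝ → ℝ := fun e r => ∫ y in (0 : ℝ)..r, ψ e y
  let f₁ : E → ℝ → E →L[ℝ] ℝ := fun e r => ∫ y in (0 : ℝ)..r, ψ' e y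
  let f₂ : E → ℝ → ℝ →L[ℝ] ℝ := fun e r => ψ e r • ContinuousLinearMap.id ℝ ℝ
  have hf₁ : Continuous ↿f₁ := by
    refine intervalIntegral.continuous_parametric_intervalIntegral_of_continuous
      (f := fun (z : E × ℝ) y => ψ' z.1 y) ?_ continuous_snd
    exact hψ'.comp ((continuous_fst.comp continuous_fst).prodMk continuous_snd)
  have hf₂ : Continuous ↿f₂ := hψ.smul continuous_const
  have hprim : ∀ w : E →L[ℝ] ℝ, HasFDerivAt (fun e => ∫ y in (0 : ℝ)..w e, ψ e y)
      ((∫ y in (0 : ℝ)..w e₀, ψ' e₀ y) + ψ e₀ (w e₀) • w) e₀ := by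
    intro w
    -- The integral from 0 to `r` has continuous partial derivatives in `e` and `r`, hence is
    -- differentiable jointly; the chain rule then inserts `r = w e`.
    have hstrict := hasStrictFDerivAt_uncurry_coprod (𝕜 := ℝ) (u := (e₀, w e₀)) (f := f) (f₁ := f₁)
      (f₂ := f₂)
      (Filter.Eventually.of_forall fun z => hasFDerivAt_intervalIntegral_param hψ hψ' hder 0 z.2 z.1)
      (Filter.Eventually.of_forall fun z => by
        have := ((hc1 z.1).integral_hasStrictDerivAt 0 z.2).hasDerivAt.hasFDerivAt
        refine this.congr_fderiv ?_
        ext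
        simp [f₂, Function.HasUncurry.uncurry])
      hf₁.continuousAt hf₂.continuousAt
    have hcomp := hstrict.hasFDerivAt.comp e₀ ((hasFDerivAt_id e₀).prodMk w.hasFDerivAt)
    refine hcomp.congr_fderiv ?_
    ext e
    simp [f₁, f₂, Function.HasUncurry.uncurry]
  have hsub := (hprim v).sub (hprim u)
  have hI : ∀ e x y, IntervalIntegrable (ψ e) volume x y := fun e x y =>
    (hc1 e).intervalIntegrable x y
  have hI' : ∀ x y, IntervalIntegrable (ψ' e₀) volume x y := fun x y =>
    (hc2 e₀).intervalIntegrable x y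
  refine (hsub.congr_of_eventuallyEq (Filter.Eventually.of_forall fun e => ?_)).congr_fderiv ?_
  · exact (intervalIntegral.integral_interval_sub_left (hI _ _ _) (hI _ _ _)).symm
  · rw [← intervalIntegral.integral_interval_sub_left (hI' 0 (v e₀)) (hI' 0 (u e₀))]
    abel

theorem continuous_intervalIntegral_endpoints {Z F : Type*} [TopologicalSpace Z]
    [FirstCountableTopology Z] [LocallyCompactSpace Z] [NormedAddCommGroup F] [NormedSpace ℝ F]
    {ψ : Z → ℝ → F} (hψ : Continuous ↿ψ) {u v : Z → ℝ} (hu : Continuous u) (hv : Continuous v) :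
    Continuous fun z => ∫ y in u z..v z, ψ z y := by
  have hI : ∀ z x y, IntervalIntegrable (ψ z) volume x y := fun z x y =>
    (hψ.comp (Continuous.prodMk_right z)).intervalIntegrable x y
  have h : (fun z => ∫ y in u z..v z, ψ z y)
      = fun z => (∫ y in (0 : ℝ)..v z, ψ z y) - ∫ y in (0 : ℝ)..u z, ψ z y := by
    funext z
    exact (intervalIntegral.integral_interval_sub_left (hI _ _ _) (hI _ _ _)).symm
  rw [h]
  exact (intervalIntegral.continuous_parametric_intervalIntegral_of_continuous hψ hv).sub
    (intervalIntegral.continuous_parametric_intervalIntegral_of_continuous hψ hu)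

/-- The two end strips cost at most `M` per unit length; over `[a', b']` only the difference of the
integrands is left. -/
theorem abs_intervalIntegral_sub_le {φ φ' : ℝ → ℝ} (hφ : Continuous φ) (hφ' : Continuous φ')
    {M ε : ℝ} (hM : ∀ y, |φ y| ≤ M) (hε : ∀ y, |φ y - φ' y| ≤ ε) (a b a' b' : ℝ) :
    |(∫ y in a..b, φ y) - ∫ y in a'..b', φ' y| ≤ M * |a - a'| + M * |b - b'| + |b' - a'| * ε := by
  have hI : ∀ x y, IntervalIntegrable φ volume x y := fun x y => hφ.intervalIntegrable x y
  have h1 : (∫ y in a..b, φ y) - ∫ y in a'..b', φ' y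
      = (∫ y in a..a', φ y) + (∫ y in b'..b, φ y) + ∫ y in a'..b', (φ y - φ' y) := by
    rw [intervalIntegral.integral_sub (hI _ _) (hφ'.intervalIntegrable _ _),
      ← intervalIntegral.integral_add_adjacent_intervals (hI a a') (hI a' b),
      ← intervalIntegral.integral_add_adjacent_intervals (hI a' b') (hI b' b)]
    ring
  have h2 : ∀ x y, |∫ r in x..y, φ r| ≤ M * |y - x| := fun x y => by
    rw [← Real.norm_eq_abs]
    exact intervalIntegral.norm_integral_le_of_norm_le_const fun r _ => hM r
  have h3 : |∫ y in a'..b', (φ y - φ' y)| ≤ ε * |b' - a'| := by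
    rw [← Real.norm_eq_abs]
    exact intervalIntegral.norm_integral_le_of_norm_le_const fun r _ => hε r
  rw [h1]
  refine (abs_add_three _ _ _).trans ?_
  have := h2 a a'
  have := h2 b' b
  rw [abs_sub_comm a a']
  linarith

end LeibnizRule

/-! ### Integrals over cuboids and their derivatives in the edges. -/

noncomputable section

namespace FDOT

/-- The end points of the edges of a cuboid: the lower ones and the upper ones. -/
abbrev Edges := (Fin 3 → ℝ) × (Fin 3 → ℝ)

/-- A double integral over a rectangle. -/
def rectInt (h : ℝ → ℝ → ℝ) (a b u v : ℝ) : ℝ := ∫ y in a..b, ∫ z in u..v, h y z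

/-- The integral over the face of a cuboid on which the coordinate `d` is equal to `r`. -/
def faceInt (g : Point → ℝ) (d : Fin 3) (r : ℝ) (p : Edges) : ℝ :=
  rectInt (fun y z => g (d.insertNth r ![y, z])) (p.1 (d.succAbove 0)) (p.2 (d.succAbove 0))
    (p.1 (d.succAbove 1)) (p.2 (d.succAbove 1))

/-- The integral over a cuboid. -/
def cuboidInt (g : Point → ℝ) (p : Edges) : ℝ :=
  ∫ y in p.1 0..p.2 0, ∫ z in p.1 1..p.2 1, ∫ w in p.1 2..p.2 2, g ![y, z, w]

/-- The coordinate forms on the space of edges. -/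
def lowerForm (d : Fin 3) : Edges →L[ℝ] ℝ :=
  ContinuousLinearMap.proj d ∘L ContinuousLinearMap.fst ℝ _ _

def upperForm (d : Fin 3) : Edges →L[ℝ] ℝ :=
  ContinuousLinearMap.proj d ∘L ContinuousLinearMap.snd ℝ _ _

theorem insertNth_zero' (r y z : ℝ) :
    (Fin.insertNth (α := fun _ => ℝ) (0 : Fin 3) r ![y, z] : Fin 3 → ℝ) = ![r, y, z] := by
  funext i; fin_cases i <;> rfl

theorem insertNth_one' (r y z : ℝ) :
    (Fin.insertNth (α := fun _ => ℝ) (1 : Fin 3) r ![y, z] : Fin 3 → ℝ) = ![y, r, z] := by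
  funext i; fin_cases i <;> rfl

theorem insertNth_two' (r y z : ℝ) :
    (Fin.insertNth (α := fun _ => ℝ) (2 : Fin 3) r ![y, z] : Fin 3 → ℝ) = ![y, z, r] := by
  funext i; fin_cases i <;> rfl

/-- The derivative of the integral over a cuboid with respect to its edges. -/
theorem hasFDerivAt_cuboidInt {g : Point → ℝ} (hg : Continuous g) (p : Edges) :
    HasFDerivAt (cuboidInt g) (∑ d, (faceInt g d (p.2 d) p • upperForm d
      - faceInt g d (p.1 d) p • lowerForm d)) p := by
  have hcl : ∀ d, Continuous fun p : Edges => p.1 d := fun d => by fun_prop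
  have hcu : ∀ d, Continuous fun p : Edges => p.2 d := fun d => by fun_prop
  have hvec : ∀ {Z : Type} [TopologicalSpace Z] {a b c : Z → ℝ}, Continuous a → Continuous b →
      Continuous c → Continuous fun z => g ![a z, b z, c z] := by
    intro Z _ a b c ha hb hc
    refine hg.comp (continuous_pi fun i => ?_)
    fin_cases i
    exacts [ha, hb, hc]
  -- The end point rule is applied from the inside out, always with the full edge vector as
  -- parameter. Each level adds the two face terms of its own coordinate and integrates those
  -- already present.
  let J₂ : Edges → ℝ → ℝ → ℝ := fun e y z => ∫ w in e.1 2..e.2 2, g ![y, z, w]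
  have hJ₂ : Continuous fun q : Edges × ℝ × ℝ => J₂ q.1 q.2.1 q.2.2 := by
    refine continuous_intervalIntegral_endpoints (ψ := fun (q : Edges × ℝ × ℝ) w =>
      g ![q.2.1, q.2.2, w]) ?_ (by fun_prop) (by fun_prop)
    exact hvec (a := fun q : (Edges × ℝ × ℝ) × ℝ => q.1.2.1) (by fun_prop) (by fun_prop)
      (by fun_prop)
  let J₂' : Edges → ℝ → ℝ → Edges →L[ℝ] ℝ := fun e y z =>
    g ![y, z, e.2 2] • upperForm 2 - g ![y, z, e.1 2] • lowerForm 2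
  have hJ₂' : Continuous fun q : Edges × ℝ × ℝ => J₂' q.1 q.2.1 q.2.2 :=
    ((hvec (by fun_prop) (by fun_prop) (by fun_prop)).smul continuous_const).sub
      ((hvec (by fun_prop) (by fun_prop) (by fun_prop)).smul continuous_const)
  have hd₂ : ∀ e y z, HasFDerivAt (fun e => J₂ e y z) (J₂' e y z) e := by
    intro e y z
    have := hasFDerivAt_intervalIntegral_endpoints (E := Edges) (ψ := fun _ w => g ![y, z, w])
      (ψ' := fun _ _ => 0)
      (hvec (a := fun _ : Edges × ℝ => y) (by fun_prop) (by fun_prop) continuous_snd)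
      continuous_const (fun e w => hasFDerivAt_const _ _) (lowerForm 2) (upperForm 2) e
    refine this.congr_fderiv ?_
    simp [J₂', upperForm, lowerForm]
  let J₁ : Edges → ℝ → ℝ := fun e y => ∫ z in e.1 1..e.2 1, J₂ e y z
  have hJ₁ : Continuous ↿J₁ := by
    refine continuous_intervalIntegral_endpoints (ψ := fun (q : Edges × ℝ) z => J₂ q.1 q.2 z)
      ?_ (by fun_prop) (by fun_prop)
    exact hJ₂.comp (f := fun q : (Edges × ℝ) × ℝ => (q.1.1, q.1.2, q.2)) (by fun_prop)
  let J₁' : Edges → ℝ → Edges →L[ℝ] ℝ := fun e y => (∫ z in e.1 1..e.2 1, J₂' e y z)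
    + J₂ e y (e.2 1) • upperForm 1 - J₂ e y (e.1 1) • lowerForm 1
  have hJ₁' : Continuous ↿J₁' := by
    refine Continuous.sub (Continuous.add ?_ (Continuous.fun_smul ?_ continuous_const))
      (Continuous.fun_smul ?_ continuous_const)
    · refine continuous_intervalIntegral_endpoints (ψ := fun (q : Edges × ℝ) z => J₂' q.1 q.2 z)
        ?_ (by fun_prop) (by fun_prop)
      exact hJ₂'.comp (f := fun q : (Edges × ℝ) × ℝ => (q.1.1, q.1.2, q.2)) (by fun_prop)
    · exact hJ₂.comp (f := fun q : Edges × ℝ => (q.1, q.2, q.1.2 1)) (by fun_prop)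
    · exact hJ₂.comp (f := fun q : Edges × ℝ => (q.1, q.2, q.1.1 1)) (by fun_prop)
  have hd₁ : ∀ e y, HasFDerivAt (fun e => J₁ e y) (J₁' e y) e := by
    intro e y
    exact hasFDerivAt_intervalIntegral_endpoints (ψ := fun e z => J₂ e y z)
      (ψ' := fun e z => J₂' e y z)
      (hJ₂.comp (f := fun q : Edges × ℝ => (q.1, y, q.2)) (by fun_prop))
      (hJ₂'.comp (f := fun q : Edges × ℝ => (q.1, y, q.2)) (by fun_prop))
      (fun e z => hd₂ e y z) (lowerForm 1) (upperForm 1) e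
  have hd₀ := hasFDerivAt_intervalIntegral_endpoints hJ₁ hJ₁' hd₁ (lowerForm 0) (upperForm 0) p
  refine hd₀.congr_fderiv ?_
  have hG : ∀ r : ℝ, Continuous fun q : ℝ × ℝ => g ![q.1, q.2, r] := fun r =>
    hvec (by fun_prop) (by fun_prop) (by fun_prop)
  have e₂ : ∀ y, ∫ z in p.1 1..p.2 1, J₂' p y z
      = (∫ z in p.1 1..p.2 1, g ![y, z, p.2 2]) • upperForm 2
        - (∫ z in p.1 1..p.2 1, g ![y, z, p.1 2]) • lowerForm 2 := by
    intro y
    have hc : ∀ r, Continuous fun z => g ![y, z, r] := fun r =>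
      (hG r).comp (f := fun z => (y, z)) (by fun_prop)
    rw [intervalIntegral.integral_sub, intervalIntegral.integral_smul_const,
      intervalIntegral.integral_smul_const]
    · exact ((hc _).smul continuous_const).intervalIntegrable _ _
    · exact ((hc _).smul continuous_const).intervalIntegrable _ _
  have hH : ∀ r : ℝ, Continuous fun y => ∫ z in p.1 1..p.2 1, g ![y, z, r] := fun r =>
    continuous_intervalIntegral_endpoints (ψ := fun y z => g ![y, z, r]) (hG r)
      continuous_const continuous_const
  have hJ : ∀ r, Continuous fun y => J₂ p y r := fun r =>
    hJ₂.comp (f := fun y => (p, y, r)) (by fun_prop)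
  have e₁ : ∫ y in p.1 0..p.2 0, J₁' p y
      = (∫ y in p.1 0..p.2 0, ∫ z in p.1 1..p.2 1, g ![y, z, p.2 2]) • upperForm 2
        - (∫ y in p.1 0..p.2 0, ∫ z in p.1 1..p.2 1, g ![y, z, p.1 2]) • lowerForm 2
        + (∫ y in p.1 0..p.2 0, J₂ p y (p.2 1)) • upperForm 1
        - (∫ y in p.1 0..p.2 0, J₂ p y (p.1 1)) • lowerForm 1 := by
    simp only [J₁', e₂]
    have hi : ∀ {h : ℝ → ℝ} (φ : Edges →L[ℝ] ℝ), Continuous h →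
        IntervalIntegrable (fun y => h y • φ) volume (p.1 0) (p.2 0) := fun φ hh =>
      (hh.smul continuous_const).intervalIntegrable _ _
    rw [intervalIntegral.integral_sub, intervalIntegral.integral_add,
      intervalIntegral.integral_sub]
    · simp only [intervalIntegral.integral_smul_const]
    · exact hi _ (hH _)
    · exact hi _ (hH _)
    · exact (hi _ (hH _)).sub (hi _ (hH _))
    · exact hi _ (hJ _)
    · exact ((hi _ (hH _)).sub (hi _ (hH _))).add (hi _ (hJ _))
    · exact hi _ (hJ _)
  have hf0 : ∀ r, faceInt g 0 r p = J₁ p r := fun r => by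
    simp only [faceInt, rectInt, insertNth_zero']; rfl
  have hf1 : ∀ r, faceInt g 1 r p = ∫ y in p.1 0..p.2 0, J₂ p y r := fun r => by
    simp only [faceInt, rectInt, insertNth_one']; rfl
  have hf2 : ∀ r, faceInt g 2 r p = ∫ y in p.1 0..p.2 0, ∫ z in p.1 1..p.2 1, g ![y, z, r] :=
    fun r => by simp only [faceInt, rectInt, insertNth_two']; rfl
  simp only [Fin.sum_univ_three, hf0, hf1, hf2]
  change (∫ y in p.1 0..p.2 0, J₁' p y) + J₁ p (p.2 0) • upperForm 0
    - J₁ p (p.1 0) • lowerForm 0 = _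
  rw [e₁]
  abel

/-- Integrals over open cuboids as iterated integrals. -/
theorem setIntegral_pi_Ioo_eq_cuboidInt {g : Point → ℝ} (hg : Continuous g) {p : Edges}
    (hp : ∀ d, p.1 d ≤ p.2 d) :
    ∫ y in Set.pi Set.univ (fun d => Set.Ioo (p.1 d) (p.2 d)), g y = cuboidInt g p := by
  have hvec : Continuous fun q : ℝ × ℝ × ℝ => g ![q.1, q.2.1, q.2.2] := by
    refine hg.comp (continuous_pi fun i => ?_)
    fin_cases i
    exacts [by fun_prop, by fun_prop, by fun_prop]
  let e : (Fin 3 → ℝ) ≃ᵐ ℝ × ℝ × ℝ := (MeasurableEquiv.piFinSuccAbove (fun _ => ℝ) 0).trans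
    ((MeasurableEquiv.refl ℝ).prodCongr MeasurableEquiv.finTwoArrow)
  have he : MeasurePreserving e volume volume :=
    ((MeasurePreserving.id volume).prod (volume_preserving_finTwoArrow ℝ)).comp
      (volume_preserving_piFinSuccAbove (fun _ => ℝ) 0)
  have happ : ∀ y, e y = (y 0, y 1, y 2) := fun y => rfl
  have hpre : Set.pi Set.univ (fun d => Set.Ioo (p.1 d) (p.2 d)) = e ⁻¹' (Set.Ioo (p.1 0) (p.2 0) ×ˢ
      (Set.Ioo (p.1 1) (p.2 1) ×ˢ Set.Ioo (p.1 2) (p.2 2))) := by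
    ext y
    simp only [Set.mem_pi, Set.mem_univ, true_implies, Set.mem_preimage, happ, Set.mem_prod,
      Fin.forall_fin_succ, IsEmpty.forall_iff, and_true]
    rfl
  have hgy : ∀ y, g y = (fun q : ℝ × ℝ × ℝ => g ![q.1, q.2.1, q.2.2]) (e y) := by
    intro y
    simp only [happ]
    congr 1
    funext i; fin_cases i <;> rfl
  have hii : ∀ {h : ℝ → ℝ} d, ∫ y in Set.Ioo (p.1 d) (p.2 d), h y = ∫ y in p.1 d..p.2 d, h y :=
    fun d => by rw [intervalIntegral.integral_of_le (hp d), integral_Ioc_eq_integral_Ioo]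
  refine (integral_congr_ae (Filter.Eventually.of_forall hgy)).trans ?_
  rw [hpre]
  refine (he.setIntegral_preimage_emb e.measurableEmbedding
    (fun q : ℝ × ℝ × ℝ => g ![q.1, q.2.1, q.2.2]) _).trans ?_
  rw [Measure.volume_eq_prod, setIntegral_prod, hii]
  · refine intervalIntegral.integral_congr fun y _ => ?_
    simp only
    rw [Measure.volume_eq_prod, setIntegral_prod, hii]
    · exact intervalIntegral.integral_congr fun z _ => hii 2
    · refine (Continuous.continuousOn ?_).integrableOn_compact (isCompact_Icc.prod isCompact_Icc)
        |>.mono_set (Set.prod_mono Set.Ioo_subset_Icc_self Set.Ioo_subset_Icc_self)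
      exact hvec.comp (f := fun q : ℝ × ℝ => (y, q)) (by fun_prop)
  · exact (hvec.continuousOn).integrableOn_compact
      (isCompact_Icc.prod (isCompact_Icc.prod isCompact_Icc))
      |>.mono_set (Set.prod_mono Set.Ioo_subset_Icc_self
        (Set.prod_mono Set.Ioo_subset_Icc_self Set.Ioo_subset_Icc_self))

end FDOT
end

/-! ### Weak integrals of families of functionals. -/

section Families

variable {T V : Type*} [TopologicalSpace T] [NormedAddCommGroup V] [NormedSpace ℝ V]

/-- A pointwise continuous and bounded family of functionals. -/
structure IsBoundedFamily (Φ : T → V →L[ℝ] ℝ) : Prop where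
  cont : ∀ x, Continuous fun τ => Φ τ x
  bound : ∃ M, ∀ τ, ‖Φ τ‖ ≤ M

theorem norm_integral_family_le {Φ : ℝ → V →L[ℝ] ℝ} {M : ℝ} (hM : ∀ y, ‖Φ y‖ ≤ M) (a b : ℝ)
    (x : V) : ‖∫ y in a..b, Φ y x‖ ≤ |b - a| * M * ‖x‖ := by
  refine (intervalIntegral.norm_integral_le_of_norm_le_const (C := M * ‖x‖) fun y _ =>
    (Φ y).le_of_opNorm_le (hM y) x).trans_eq ?_
  ring

theorem IsBoundedFamily.continuous_right {Φ : T × ℝ → V →L[ℝ] ℝ} (h : IsBoundedFamily Φ) (τ : T)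
    (x : V) : Continuous fun y => Φ (τ, y) x :=
  (h.cont x).comp (Continuous.prodMk_right τ)

/-- The integral of a family of functionals over its last variable. -/
noncomputable def lineInt (Φ : T × ℝ → V →L[ℝ] ℝ) (h : IsBoundedFamily Φ) (a b : ℝ) (τ : T) :
    V →L[ℝ] ℝ :=
  LinearMap.mkContinuousOfExistsBound
    { toFun := fun x => ∫ y in a..b, Φ (τ, y) x
      map_add' := fun x x' => by
        simp only [map_add]
        exact intervalIntegral.integral_add ((h.continuous_right τ x).intervalIntegrable _ _)
          ((h.continuous_right τ x').intervalIntegrable _ _)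
      map_smul' := fun c x => by
        rw [RingHom.id_apply, ← intervalIntegral.integral_smul]
        exact intervalIntegral.integral_congr fun y _ => (Φ (τ, y)).map_smul c x }
    (h.bound.imp' (fun M => |b - a| * M) fun _ hM x =>
      norm_integral_family_le (fun y => hM (τ, y)) a b x)

variable {Φ Φ' : T × ℝ → V →L[ℝ] ℝ} (h : IsBoundedFamily Φ) (h' : IsBoundedFamily Φ')

theorem norm_lineInt_le {M R : ℝ} (hM : ∀ τ, ‖Φ τ‖ ≤ M) {a b : ℝ} (hR : |b - a| ≤ R) (τ : T) :
    ‖lineInt Φ h a b τ‖ ≤ R * M := by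
  have hM0 : 0 ≤ M := (norm_nonneg _).trans (hM (τ, 0))
  have hR0 : 0 ≤ R := (abs_nonneg _).trans hR
  refine ContinuousLinearMap.opNorm_le_bound _ (by positivity) fun x => ?_
  refine (norm_integral_family_le (fun y => hM (τ, y)) a b x).trans ?_
  gcongr

/-- Closure under integration allows iterated integrals to be built one coordinate at a time, until
only the parameter `Unit` remains. -/
theorem isBoundedFamily_lineInt [FirstCountableTopology T] [LocallyCompactSpace T] (a b : ℝ) :
    IsBoundedFamily (lineInt Φ h a b) where
  cont x := continuous_intervalIntegral_endpoints (ψ := fun τ y => Φ (τ, y) x) (h.cont x)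
    continuous_const continuous_const
  bound := by
    obtain ⟨M, hM⟩ := h.bound
    exact ⟨|b - a| * M, fun τ => norm_lineInt_le h hM le_rfl τ⟩

/-- The scalar comparison is linear in `‖x‖`, so it becomes an operator norm bound. Pointwise
continuity of the families suffices; this is essential, as point evaluations are not norm-continuous
in the point. -/
theorem norm_lineInt_sub_le {M R ε η : ℝ} (hM : ∀ τ, ‖Φ τ‖ ≤ M) (hε : ∀ τ, ‖Φ τ - Φ' τ‖ ≤ ε)
    {a b a' b' : ℝ} (hR : |b' - a'| ≤ R) (ha : |a - a'| ≤ η) (hb : |b - b'| ≤ η) (τ : T) :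
    ‖lineInt Φ h a b τ - lineInt Φ' h' a' b' τ‖ ≤ 2 * M * η + R * ε := by
  have hM0 : 0 ≤ M := (norm_nonneg _).trans (hM (τ, 0))
  have hε0 : 0 ≤ ε := (norm_nonneg _).trans (hε (τ, 0))
  have hR0 : 0 ≤ R := (abs_nonneg _).trans hR
  have hη0 : 0 ≤ η := (abs_nonneg _).trans ha
  refine ContinuousLinearMap.opNorm_le_bound _ (by positivity) fun x => ?_
  have hkey := abs_intervalIntegral_sub_le (φ := fun y => Φ (τ, y) x) (φ' := fun y => Φ' (τ, y) x)
    ((h.cont x).comp (Continuous.prodMk_right τ)) ((h'.cont x).comp (Continuous.prodMk_right τ))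
    (M := M * ‖x‖) (ε := ε * ‖x‖) (fun y => (Φ (τ, y)).le_of_opNorm_le (hM _) x)
    (fun y => (Φ (τ, y) - Φ' (τ, y)).le_of_opNorm_le (hε _) x) a b a' b'
  refine hkey.trans ?_
  have h1 : M * ‖x‖ * |a - a'| ≤ M * ‖x‖ * η := by gcongr
  have h2 : M * ‖x‖ * |b - b'| ≤ M * ‖x‖ * η := by gcongr
  have h3 : |b' - a'| * (ε * ‖x‖) ≤ R * (ε * ‖x‖) := by gcongr
  linarith

end Families

/-! ### Face and cuboid functionals on jets, and their Lipschitz dependence on the edges. -/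

noncomputable section

namespace FDOT

namespace Box

variable (b : Box)

/-- A function is recovered from its values on a face of the box and from its partial derivative. -/
def recover (d : Fin 3) (r : ℝ) (y : Point) : Jet b.Carrier →L[ℝ] ℝ :=
  ContinuousMap.evalCLM ℝ (b.line d y (b.lo d)) ∘L ContinuousLinearMap.fst ℝ _ _
    + pathIntegral (b.line d y) (b.lo d) r ∘L ContinuousLinearMap.proj d
      ∘L ContinuousLinearMap.snd ℝ _ _

theorem recover_apply (d : Fin 3) (r : ℝ) (y : Point) (x : Jet b.Carrier) :
    b.recover d r y x = x.1 (b.line d y (b.lo d)) + ∫ s in b.lo d..r, x.2 d (b.line d y s) := rfl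

variable {b}

theorem recover_eq {x : Jet b.Carrier} (hx : ∀ i, b.defect i x = 0) {d : Fin 3} {r : ℝ}
    {y : Point} (hy : Function.update y d r ∈ b.toSet) :
    b.recover d r y x = x.1 (b.clamp (Function.update y d r)) := by
  have := (b.defect_eq_zero_iff d ⟨_, hy⟩ x).1 (hx _)
  rw [this, recover_apply]
  simp [line_update]

theorem norm_recover_le (d : Fin 3) (r : ℝ) (y : Point) :
    ‖b.recover d r y‖ ≤ 1 + |r - b.lo d| := by
  refine ContinuousLinearMap.opNorm_le_bound _ (by positivity) fun x => ?_
  rw [recover_apply]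
  have h1 : ‖x.1 (b.line d y (b.lo d))‖ ≤ ‖x‖ := (x.1.norm_coe_le_norm _).trans (norm_fst_le x)
  have h2 : ‖∫ s in b.lo d..r, x.2 d (b.line d y s)‖ ≤ ‖x‖ * |r - b.lo d| :=
    intervalIntegral.norm_integral_le_of_norm_le_const fun s _ =>
      ((x.2 d).norm_coe_le_norm _).trans ((norm_le_pi_norm x.2 d).trans (norm_snd_le x))
  refine (norm_add_le _ _).trans ?_
  linarith

/-- The gain from the derivative component: both functionals start from the same boundary value, and
they differ by an integral over an interval of length `|r - r'|`. -/
theorem norm_recover_sub_le (d : Fin 3) (r r' : ℝ) (y : Point) :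
    ‖b.recover d r y - b.recover d r' y‖ ≤ |r - r'| := by
  refine ContinuousLinearMap.opNorm_le_bound _ (by positivity) fun x => ?_
  rw [sub_apply, recover_apply, recover_apply, add_sub_add_left_eq_sub]
  have hc : ∀ u v, IntervalIntegrable (fun s => x.2 d (b.line d y s)) volume u v := fun u v =>
    ((x.2 d).comp (b.line d y)).continuous.intervalIntegrable u v
  rw [intervalIntegral.integral_interval_sub_left (hc _ _) (hc _ _), mul_comm]
  exact intervalIntegral.norm_integral_le_of_norm_le_const fun s _ =>
    ((x.2 d).norm_coe_le_norm _).trans ((norm_le_pi_norm x.2 d).trans (norm_snd_le x))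

theorem continuous_recover (d : Fin 3) (r : ℝ) (x : Jet b.Carrier) :
    Continuous fun y => b.recover d r y x := by
  simp only [recover_apply]
  have hline : Continuous fun q : Point × ℝ => b.line d q.1 q.2 :=
    b.clamp.continuous.comp (f := fun q : Point × ℝ => Function.update q.1 d q.2) (by fun_prop)
  refine Continuous.add ?_ ?_
  · exact x.1.continuous.comp (hline.comp (f := fun y : Point => (y, b.lo d)) (by fun_prop))
  · exact continuous_intervalIntegral_endpoints (ψ := fun y s => x.2 d (b.line d y s))
      ((x.2 d).continuous.comp hline) continuous_const continuous_const

variable (b)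

/-- The integrand of the functional belonging to a face of a cuboid. -/
def faceFamily (d : Fin 3) (r : ℝ) (q : (Unit × ℝ) × ℝ) : Jet b.Carrier →L[ℝ] ℝ :=
  b.recover d r (d.insertNth 0 ![q.1.2, q.2])

theorem isBoundedFamily_faceFamily (d : Fin 3) (r : ℝ) : IsBoundedFamily (b.faceFamily d r) where
  cont x := (continuous_recover d r x).comp (Continuous.finInsertNth d continuous_const (by
    refine continuous_pi fun i => ?_
    fin_cases i
    exacts [by fun_prop, by fun_prop]))
  bound := ⟨1 + |r - b.lo d|, fun _ => norm_recover_le d r _⟩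

/-- The integral over the face of a cuboid, as a functional on functions with partial
derivatives. -/
def faceFunctional (d : Fin 3) (r : ℝ) (p : Edges) : Jet b.Carrier →L[ℝ] ℝ :=
  lineInt _ (isBoundedFamily_lineInt (b.isBoundedFamily_faceFamily d r)
    (p.1 (d.succAbove 1)) (p.2 (d.succAbove 1))) (p.1 (d.succAbove 0)) (p.2 (d.succAbove 0)) ()

/-- The integrand of the functional belonging to the cuboid. -/
def cuboidFamily (q : ((Unit × ℝ) × ℝ) × ℝ) : Jet b.Carrier →L[ℝ] ℝ :=
  ContinuousMap.evalCLM ℝ (b.clamp ![q.1.1.2, q.1.2, q.2]) ∘L ContinuousLinearMap.fst ℝ _ _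

theorem norm_cuboidFamily_le (q : ((Unit × ℝ) × ℝ) × ℝ) : ‖b.cuboidFamily q‖ ≤ 1 :=
  ContinuousLinearMap.opNorm_le_bound _ zero_le_one fun x => by
    rw [one_mul]
    exact (x.1.norm_coe_le_norm _).trans (norm_fst_le x)

theorem isBoundedFamily_cuboidFamily : IsBoundedFamily b.cuboidFamily where
  cont x := by
    refine x.1.continuous.comp (b.clamp.continuous.comp (continuous_pi fun i => ?_))
    fin_cases i
    exacts [by fun_prop, by fun_prop, by fun_prop]
  bound := ⟨1, b.norm_cuboidFamily_le⟩

/-- The integral over a cuboid, as a functional on functions with partial derivatives. -/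
def cuboidFunctional (p : Edges) : Jet b.Carrier →L[ℝ] ℝ :=
  lineInt _ (isBoundedFamily_lineInt (isBoundedFamily_lineInt b.isBoundedFamily_cuboidFamily
    (p.1 2) (p.2 2)) (p.1 1) (p.2 1)) (p.1 0) (p.2 0) ()

theorem cuboidFunctional_apply (p : Edges) (x : Jet b.Carrier) :
    b.cuboidFunctional p x = cuboidInt (fun y => x.1 (b.clamp y)) p := rfl

/-- The edges of the nondegenerate cuboids in the interior of the box. -/
def innerEdges : Set Edges := {p | ∀ d, b.lo d < p.1 d ∧ p.1 d < p.2 d ∧ p.2 d < b.hi d}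

theorem faceFunctional_apply {p : Edges} (hp : p ∈ b.innerEdges) {d : Fin 3} {r : ℝ}
    (hr : r ∈ Set.Icc (b.lo d) (b.hi d)) {x : Jet b.Carrier} (hx : ∀ i, b.defect i x = 0) :
    b.faceFunctional d r p x = faceInt (fun y => x.1 (b.clamp y)) d r p := by
  have hupd : ∀ y z : ℝ, Function.update (d.insertNth 0 ![y, z] : Point) d r
      = d.insertNth r ![y, z] := fun y z => by simp
  refine intervalIntegral.integral_congr fun y hy => intervalIntegral.integral_congr fun z hz => ?_
  rw [Set.uIcc_of_le (hp _).2.1.le] at hy hz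
  have hmem : Function.update (d.insertNth 0 ![y, z] : Point) d r ∈ b.toSet := by
    rw [hupd]
    refine (Fin.forall_iff_succAbove d).2 ⟨by simpa using hr, fun i => ?_⟩
    rw [Fin.insertNth_apply_succAbove]
    have h0 := hp (d.succAbove 0)
    have h1 := hp (d.succAbove 1)
    fin_cases i
    · exact ⟨h0.1.le.trans hy.1, hy.2.trans h0.2.2.le⟩
    · exact ⟨h1.1.le.trans hz.1, hz.2.trans h1.2.2.le⟩
  have := recover_eq hx hmem
  simp only [hupd] at this
  exact this

theorem exists_lipschitz_faceFunctional (d : Fin 3) : ∃ C, 0 ≤ C ∧ ∀ p ∈ b.innerEdges,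
    ∀ p' ∈ b.innerEdges, ∀ r ∈ Set.Icc (b.lo d) (b.hi d), ∀ r', |r - r'| ≤ dist p p' →
    ‖b.faceFunctional d r p - b.faceFunctional d r' p'‖ ≤ C * dist p p' := by
  obtain ⟨R, hR0, hR⟩ : ∃ R, 0 ≤ R ∧ ∀ d, b.hi d - b.lo d ≤ R :=
    ⟨∑ d, (b.hi d - b.lo d), Finset.sum_nonneg fun d _ => sub_nonneg.2 (b.le d), fun d =>
      Finset.single_le_sum (f := fun d => b.hi d - b.lo d)
        (fun d _ => sub_nonneg.2 (b.le d)) (Finset.mem_univ d)⟩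
  -- Two applications of `norm_lineInt_sub_le`: the integrand has norm at most `1 + R` and Lipschitz
  -- constant 1 in `r`, and `R` bounds all side lengths of the box.
  refine ⟨2 * (R * (1 + R)) + R * (2 * (1 + R) + R), by positivity,
    fun p hp p' hp' r hr r' hrr => ?_⟩
  have hlen : ∀ p ∈ b.innerEdges, ∀ d, |p.2 d - p.1 d| ≤ R := fun p hp d => by
    have := hp d
    rw [abs_of_pos (by linarith)]
    linarith [hR d]
  have h1 : ∀ d, |p.1 d - p'.1 d| ≤ dist p p' := fun d =>
    (dist_le_pi_dist p.1 p'.1 d).trans (le_max_left _ _)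
  have h2 : ∀ d, |p.2 d - p'.2 d| ≤ dist p p' := fun d =>
    (dist_le_pi_dist p.2 p'.2 d).trans (le_max_right _ _)
  have hM : ∀ q, ‖b.faceFamily d r q‖ ≤ 1 + R := fun q => by
    refine (norm_recover_le d r _).trans ?_
    rw [abs_of_nonneg (sub_nonneg.2 hr.1)]
    linarith [hR d, hr.2]
  have hin := norm_lineInt_sub_le (b.isBoundedFamily_faceFamily d r)
    (b.isBoundedFamily_faceFamily d r') hM (fun q => (norm_recover_sub_le d r r' _).trans hrr)
    (hlen p' hp' (d.succAbove 1)) (h1 (d.succAbove 1)) (h2 (d.succAbove 1))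
  have hout := norm_lineInt_sub_le
    (isBoundedFamily_lineInt (b.isBoundedFamily_faceFamily d r) _ _)
    (isBoundedFamily_lineInt (b.isBoundedFamily_faceFamily d r') _ _)
    (norm_lineInt_le (b.isBoundedFamily_faceFamily d r) hM (hlen p hp (d.succAbove 1))) hin
    (hlen p' hp' (d.succAbove 0)) (h1 (d.succAbove 0)) (h2 (d.succAbove 0)) ()
  exact hout.trans_eq (by ring)

theorem exists_lipschitz_cuboidFunctional : ∃ C, 0 ≤ C ∧ ∀ p ∈ b.innerEdges,
    ∀ p' ∈ b.innerEdges, ‖b.cuboidFunctional p - b.cuboidFunctional p'‖ ≤ C * dist p p' := by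
  obtain ⟨R, hR0, hR⟩ : ∃ R, 0 ≤ R ∧ ∀ d, b.hi d - b.lo d ≤ R :=
    ⟨∑ d, (b.hi d - b.lo d), Finset.sum_nonneg fun d _ => sub_nonneg.2 (b.le d), fun d =>
      Finset.single_le_sum (f := fun d => b.hi d - b.lo d)
        (fun d _ => sub_nonneg.2 (b.le d)) (Finset.mem_univ d)⟩
  refine ⟨2 * (R * (R * 1)) + R * (2 * (R * 1) + R * 2), by positivity,
    fun p hp p' hp' => ?_⟩
  have hlen : ∀ p ∈ b.innerEdges, ∀ d, |p.2 d - p.1 d| ≤ R := fun p hp d => by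
    have := hp d
    rw [abs_of_pos (by linarith)]
    linarith [hR d]
  have h1 : ∀ d, |p.1 d - p'.1 d| ≤ dist p p' := fun d =>
    (dist_le_pi_dist p.1 p'.1 d).trans (le_max_left _ _)
  have h2 : ∀ d, |p.2 d - p'.2 d| ≤ dist p p' := fun d =>
    (dist_le_pi_dist p.2 p'.2 d).trans (le_max_right _ _)
  have hc := b.isBoundedFamily_cuboidFamily
  have hM := b.norm_cuboidFamily_le
  have hin := norm_lineInt_sub_le hc hc hM (fun q => by rw [sub_self, norm_zero])
    (hlen p' hp' 2) (h1 2) (h2 2)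
  have hmid := norm_lineInt_sub_le (isBoundedFamily_lineInt hc _ _)
    (isBoundedFamily_lineInt hc _ _) (norm_lineInt_le hc hM (hlen p hp 2)) hin
    (hlen p' hp' 1) (h1 1) (h2 1)
  have hout := norm_lineInt_sub_le (isBoundedFamily_lineInt (isBoundedFamily_lineInt hc _ _) _ _)
    (isBoundedFamily_lineInt (isBoundedFamily_lineInt hc _ _) _ _)
    (norm_lineInt_le (isBoundedFamily_lineInt hc _ _) (norm_lineInt_le hc hM (hlen p hp 2))
      (hlen p hp 1)) hmid (hlen p' hp' 0) (h1 0) (h2 0) ()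
  exact hout.trans_eq (by ring)

/-- The functionals which give the derivatives of an integral over a cuboid with respect to its
edges and to the constant factor. -/
def edgeFunctional (p : Edges) : Fin 7 → Jet b.Carrier →L[ℝ] ℝ :=
  ![-b.faceFunctional 0 (p.1 0) p, b.faceFunctional 0 (p.2 0) p,
    -b.faceFunctional 1 (p.1 1) p, b.faceFunctional 1 (p.2 1) p,
    -b.faceFunctional 2 (p.1 2) p, b.faceFunctional 2 (p.2 2) p, b.cuboidFunctional p]

/-- The operator norm regularity required of the parameter map `L` in the zero set argument. -/
theorem exists_lipschitzOnWith_edgeFunctional :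
    ∃ C, LipschitzOnWith C b.edgeFunctional b.innerEdges := by
  choose C hC0 hC using b.exists_lipschitz_faceFunctional
  obtain ⟨C', hC0', hC'⟩ := b.exists_lipschitz_cuboidFunctional
  have key := LipschitzOnWith.of_dist_le_mul (f := b.edgeFunctional) (s := b.innerEdges)
    (K := Real.toNNReal (C 0 + C 1 + C 2 + C')) ?_
  · exact ⟨_, key⟩
  intro p hp p' hp'
  rw [Real.coe_toNNReal _ (by linarith [hC0 0, hC0 1, hC0 2])]
  have hd := dist_nonneg (x := p) (y := p')
  have hu : ∀ d, ‖b.faceFunctional d (p.2 d) p - b.faceFunctional d (p'.2 d) p'‖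
      ≤ C d * dist p p' := fun d => hC d p hp p' hp' _
    ⟨by linarith [(hp d).1, (hp d).2.1], (hp d).2.2.le⟩ _
    ((dist_le_pi_dist p.2 p'.2 d).trans (le_max_right _ _))
  have hl : ∀ d, ‖b.faceFunctional d (p.1 d) p - b.faceFunctional d (p'.1 d) p'‖
      ≤ C d * dist p p' := fun d => hC d p hp p' hp' _
    ⟨(hp d).1.le, by linarith [(hp d).2.1, (hp d).2.2]⟩ _
    ((dist_le_pi_dist p.1 p'.1 d).trans (le_max_left _ _))
  have hl' : ∀ d, ‖-b.faceFunctional d (p.1 d) p - -b.faceFunctional d (p'.1 d) p'‖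
      ≤ C d * dist p p' := fun d => by
    rw [neg_sub_neg]; exact (norm_sub_rev (E := Jet b.Carrier →L[ℝ] ℝ) _ _).trans_le (hl d)
  have hv := hC' p hp p' hp'
  have hle : ∀ d, C d * dist p p' ≤ (C 0 + C 1 + C 2 + C') * dist p p' := fun d => by
    gcongr
    fin_cases d <;> simp <;> linarith [hC0 0, hC0 1, hC0 2]
  refine (dist_pi_le_iff (by have := hC0 0; have := hC0 1; have := hC0 2; positivity)).2
    fun j => (dist_eq_norm (E := Jet b.Carrier →L[ℝ] ℝ) _ _).trans_le ?_
  fin_cases j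
  · exact (hl' 0).trans (hle 0)
  · exact (hu 0).trans (hle 0)
  · exact (hl' 1).trans (hle 1)
  · exact (hu 1).trans (hle 1)
  · exact (hl' 2).trans (hle 2)
  · exact (hu 2).trans (hle 2)
  · exact hv.trans (mul_le_mul_of_nonneg_right (by linarith [hC0 0, hC0 1, hC0 2]) hd)

end Box

end FDOT
end

/-! ### The measured quantity as a functional of an analytic time kernel. -/

noncomputable section

namespace FDOT

/-- The edges of the cuboid with given parameters. -/
def edgesOf : Param →L[ℝ] Edges :=
  (ContinuousLinearMap.pi fun d => EuclideanSpace.proj ((![0, 2, 4] : Fin 3 → Fin 7) d)).prod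
    (ContinuousLinearMap.pi fun d => EuclideanSpace.proj ((![1, 3, 5] : Fin 3 → Fin 7) d))

theorem edgesOf_fst (a : Param) (d : Fin 3) : (edgesOf a).1 d = a ((![0, 2, 4] : Fin 3 → Fin 7) d) :=
  rfl

theorem edgesOf_snd (a : Param) (d : Fin 3) : (edgesOf a).2 d = a ((![1, 3, 5] : Fin 3 → Fin 7) d) :=
  rfl

theorem cuboid_eq_pi {a : Param} (ha : 0 < a 4) :
    cuboid a = Set.pi Set.univ fun d => Set.Ioo ((edgesOf a).1 d) ((edgesOf a).2 d) := by
  ext y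
  simp only [cuboid, halfSpace, Set.mem_ofPred_eq, Set.mem_pi, Set.mem_univ, true_implies,
    Fin.forall_fin_succ, IsEmpty.forall_iff, and_true, edgesOf_fst, edgesOf_snd]
  change _ ↔ y 0 ∈ Set.Ioo (a 0) (a 1) ∧ y 1 ∈ Set.Ioo (a 2) (a 3) ∧ y 2 ∈ Set.Ioo (a 4) (a 5)
  constructor
  · exact fun h => h.2
  · exact fun h => ⟨ha.trans h.2.2.1, h⟩

/-- At boundary points the Green function is a multiple of the excitation light. -/
theorem greenK_eq_excitation (m : Medium) {x : Point} (hx : x ∈ boundary) (y : Point) (t : ℝ) :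
    greenK m x y t = m.D⁻¹ * excitation m y t x := by
  have hx' : x 2 = 0 := hx
  have hD := m.D_pos.ne'
  rw [greenK, excitation, K3, hx', zero_add, zero_sub, neg_sq, sub_sq_comm (x 0), sub_sq_comm (x 1)]
  field_simp
  ring

section Box

variable (m : Medium) (b : Box)

theorem lo_le_incl (d : Fin 3) (k : b.Carrier) : b.lo d ≤ b.incl k d := (k d).2.1

/-- The propagation of light from a box to a detector, with its partial derivatives. -/
def detectorJet (x : Point) (t : ℝ) : Jet b.Carrier := m.D⁻¹ • excitationJet m b.incl x t

variable {b}

theorem analyticBounded_detectorJet (hb : 0 < b.lo 2) (x : Point) :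
    AnalyticBounded (detectorJet m b x) :=
  (analyticBounded_excitationJet m x hb (lo_le_incl b 2)).const_smul _

/-- By `greenK_eq_excitation` the propagator to a boundary point is again excitation light, so the
spatial integrand is the first component of a Leibniz product. Taking the time integrals in jet
space lets one functional carry all dependence on the cuboid, apart from the factor `P`. -/
theorem emission_eq_cuboidFunctional (hb : 0 < b.lo 2) (τ : ℝ) {a : Param}
    (ha : edgesOf a ∈ b.innerEdges) {xd : Point} (hxd : xd ∈ boundary) (xs : Point) {t : ℝ}
    (ht : 0 < t) :
    emission m τ a xd t xs = a 6 * b.cuboidFunctional (edgesOf a)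
      (lifetimeKernel m τ (leibniz _) (detectorJet m b xd) (excitationJet m b.incl xs) t) := by
  have hg := analyticBounded_excitationJet m xs hb (lo_le_incl b 2)
  have ha4 : 0 < a 4 := hb.trans (ha 2).1
  rw [lifetimeKernel, clm_timeConv _ (analyticBounded_detectorJet m hb xd)
    (analyticBounded_source m hg τ).analyticIntegrable _ ht, ← intervalIntegral.integral_const_mul,
    emission, intervalIntegral.integral_of_le ht.le, intervalIntegral.integral_of_le ht.le]
  refine setIntegral_congr_fun measurableSet_Ioc fun s hs => ?_
  simp only
  set S : ℝ → Jet b.Carrier := if τ = 0 then fun s => m.cf • excitationJet m b.incl xs s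
    else fun s => (m.cf / τ) • timeConv (ContinuousLinearMap.lsmul ℝ ℝ)
      (fun r => Real.exp (-r / τ)) (excitationJet m b.incl xs) s with hS
  have hmeas : MeasurableSet (cuboid a) := by
    rw [cuboid_eq_pi ha4]
    exact MeasurableSet.univ_pi fun _ => measurableSet_Ioo
  have hbox : ∀ y ∈ cuboid a, y ∈ b.toSet := by
    intro y hy d
    rw [cuboid_eq_pi ha4] at hy
    have := hy d trivial
    exact ⟨(ha d).1.le.trans this.1.le, this.2.le.trans (ha d).2.2.le⟩
  have hsrc : ∀ y ∈ cuboid a, source m τ a xs y s = a 6 * (S s).1 (b.clamp y) := by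
    intro y hy
    have hincl := Box.incl_clamp (hbox y hy)
    have hex : ∀ r, (excitationJet m b.incl xs r).1 (b.clamp y) = excitation m y r xs := fun r => by
      rw [excitationJet, excitationMap_apply, hincl]
    rw [source, muF, Set.indicator_of_mem hy, hS]
    split_ifs with hτ
    · rw [Prod.smul_fst, ContinuousMap.smul_apply, hex, smul_eq_mul]
      ring
    · have := clm_timeConv (ContinuousLinearMap.lsmul ℝ ℝ) (analyticBounded_exp_div τ)
        hg.analyticIntegrable
        (ContinuousMap.evalCLM ℝ (b.clamp y) ∘L ContinuousLinearMap.fst ℝ _ _) hs.1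
      simp only [ContinuousLinearMap.comp_apply, ContinuousLinearMap.coe_fst',
        ContinuousMap.evalCLM_apply, ContinuousLinearMap.lsmul_apply, Prod.smul_fst,
        ContinuousMap.smul_apply, hex, smul_eq_mul] at this
      rw [Prod.smul_fst, ContinuousMap.smul_apply, this, smul_eq_mul]
      ring
  have hint : ∀ y, greenK m xd y (t - s) * source m τ a xs y s = (cuboid a).indicator
      (fun y => a 6 * (leibniz _ (detectorJet m b xd (t - s)) (S s)).1 (b.clamp y)) y := by
    intro y
    by_cases hy : y ∈ cuboid a
    · rw [Set.indicator_of_mem hy, hsrc y hy, greenK_eq_excitation m hxd, leibniz_apply_fst,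
        ContinuousMap.mul_apply, detectorJet, Prod.smul_fst, ContinuousMap.smul_apply,
        excitationJet, excitationMap_apply, Box.incl_clamp (hbox y hy), smul_eq_mul]
      ring
    · rw [Set.indicator_of_notMem hy]
      simp [source, muF, Set.indicator_of_notMem hy]
  simp only [hint]
  rw [setIntegral_indicator hmeas, Set.inter_eq_right.2 fun y hy => hy.1, integral_const_mul,
    cuboid_eq_pi ha4, setIntegral_pi_Ioo_eq_cuboidInt _ fun d => (ha d).2.1.le,
    Box.cuboidFunctional_apply]
  exact (ContinuousMap.continuous _).comp b.clamp.continuous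

/-- The time dependence of the measured quantity for targets in a box. -/
def boxKernel (m : Medium) (b : Box) (u : Measurement) (ω : SDPair) : ℝ → Jet b.Carrier :=
  measurementKernel m (leibniz _) (detectorJet m b ω.1) (excitationJet m b.incl ω.2) u

theorem analyticOnNhd_boxKernel (hb : 0 < b.lo 2) (u : Measurement) (ω : SDPair) :
    AnalyticOnNhd ℝ (boxKernel m b u ω) (Set.Ioi 0) :=
  analyticOnNhd_measurementKernel m _ (analyticBounded_detectorJet m hb _)
    (analyticBounded_excitationJet m _ hb (lo_le_incl b 2)) u

/-- This guarantees that the face functionals, evaluated at the kernel, are genuine face integrals.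
-/
theorem defect_boxKernel (hb : 0 < b.lo 2) (u : Measurement) (ω : SDPair) {t : ℝ} (ht : 0 < t)
    (i : Fin 3 × b.toSet) : b.defect i (boxKernel m b u ω t) = 0 :=
  measurementKernel_mem_ker m _ (fun _ _ hx hy => b.defect_leibniz hx hy)
    (analyticBounded_detectorJet m hb _)
    (analyticBounded_excitationJet m _ hb (lo_le_incl b 2))
    (fun t ht i => by rw [detectorJet, map_smul, defect_excitationJet m b _ ht, smul_zero])
    (fun t ht i => defect_excitationJet m b _ ht i) u ht i

theorem measured_eq_cuboidFunctional (hb : 0 < b.lo 2) (u : Measurement) {a : Param}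
    (ha : edgesOf a ∈ b.innerEdges) (ω : SDPair) {t : ℝ} (ht : 0 < t) :
    measured m u a t ω = a 6 * b.cuboidFunctional (edgesOf a) (boxKernel m b u ω t) := by
  cases u with
  | zeroLifetime => exact emission_eq_cuboidFunctional m hb 0 ha ω.1.2 _ ht
  | detected q τ hτ =>
    rw [boxKernel, measurementKernel, clm_timeConv _ (analyticBounded_lifetimeKernel m _
      (analyticBounded_detectorJet m hb _)
      (analyticBounded_excitationJet m _ hb (lo_le_incl b 2)) τ) q.analyticIntegrable _ ht,
      ← intervalIntegral.integral_const_mul, measured, intervalIntegral.integral_of_le ht.le,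
      intervalIntegral.integral_of_le ht.le, integral_Ioc_eq_integral_Ioo,
      integral_Ioc_eq_integral_Ioo]
    refine setIntegral_congr_fun measurableSet_Ioo fun s hs => ?_
    simp only [ContinuousLinearMap.flip_apply, ContinuousLinearMap.lsmul_apply, map_smul,
      smul_eq_mul]
    rw [emission_eq_cuboidFunctional m hb τ ha ω.1.2 _ (sub_pos.2 hs.2)]
    ring

end Box

end FDOT
end

theorem AnalyticAt.eval_pi {X ι : Type*} [NormedAddCommGroup X] [NormedSpace ℝ X] [Fintype ι]
    {κ : ℝ → X} {t : ℝ} (hκ : AnalyticAt ℝ κ t) (L : ι → X →L[ℝ] ℝ) (j : ι) :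
    AnalyticAt ℝ (fun z : (ι → X →L[ℝ] ℝ) × ℝ => z.1 j (κ z.2)) (L, t) := by
  refine ((ContinuousLinearMap.id ℝ (X →L[ℝ] ℝ)).analyticAt_bilinear (L j, κ t)).comp_of_eq
    (x := (L, t)) (AnalyticAt.prod ?_ (hκ.comp_of_eq analyticAt_snd rfl)) rfl
  exact ((ContinuousLinearMap.proj (R := ℝ) (φ := fun _ : ι => X →L[ℝ] ℝ) j).analyticAt _).comp
    analyticAt_fst

/-! ### The Jacobian determinant in terms of functionals and kernels. -/

noncomputable section

namespace FDOT

section Determinant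

open Topology

variable (m : Medium) (b : Box) (u : Measurement)

theorem isOpen_innerEdges : IsOpen b.innerEdges := by
  have h : b.innerEdges
      = ⋂ d, {p | b.lo d < p.1 d} ∩ ({p | p.1 d < p.2 d} ∩ {p | p.2 d < b.hi d}) := by
    ext p
    simp [Box.innerEdges]
  rw [h]
  refine isOpen_iInter_of_finite fun d => ?_
  have h1 : Continuous fun p : Edges => p.1 d := by fun_prop
  have h2 : Continuous fun p : Edges => p.2 d := by fun_prop
  exact (isOpen_lt continuous_const h1).inter ((isOpen_lt h1 h2).inter (isOpen_lt h2 continuous_const))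

/-- The determinant of functionals on the box at the kernels of the measured quantity. -/
def boxDet (ω : Fin 7 → SDPair) (z : (Fin 7 → Jet b.Carrier →L[ℝ] ℝ) × ℝ) : ℝ :=
  (Matrix.of fun i j : Fin 7 => z.1 j (boxKernel m b u (ω i) z.2)).det

variable {b}

/-- Product rule for `P` times a cuboid integral: the edge derivatives are signed face integrals
times `P`, and the derivative in `P` is the cuboid integral itself. -/
theorem fderiv_measured (hb : 0 < b.lo 2) {a : Param} (ha : edgesOf a ∈ b.innerEdges) (ω : SDPair)
    {t : ℝ} (ht : 0 < t) (j : Fin 7) :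
    fderiv ℝ (fun a => measured m u a t ω) a (EuclideanSpace.single j 1)
      = (if j = 6 then 1 else a 6)
        * b.edgeFunctional (edgesOf a) j (boxKernel m b u ω t) := by
  set x := boxKernel m b u ω t with hx
  have hx0 : ∀ i, b.defect i x = 0 := defect_boxKernel m hb u ω ht
  set g : Point → ℝ := fun y => x.1 (b.clamp y) with hg
  have hgc : Continuous g := (ContinuousMap.continuous _).comp b.clamp.continuous
  have hev : (fun a => measured m u a t ω) =ᶠ[𝓝 a] fun a => a 6 * cuboidInt g (edgesOf a) := by
    filter_upwards [((isOpen_innerEdges b).preimage edgesOf.continuous).mem_nhds ha] with a' ha'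
    exact measured_eq_cuboidFunctional m hb u ha' ω ht
  have h6 : HasFDerivAt (fun a : Param => a 6) (EuclideanSpace.proj 6 : Param →L[ℝ] ℝ) a :=
    (EuclideanSpace.proj 6 : Param →L[ℝ] ℝ).hasFDerivAt
  have hd := h6.mul ((hasFDerivAt_cuboidInt hgc (edgesOf a)).comp a edgesOf.hasFDerivAt)
  have hface : ∀ d r, r ∈ Set.Icc (b.lo d) (b.hi d) →
      b.faceFunctional d r (edgesOf a) x = faceInt g d r (edgesOf a) := fun d r hr =>
    b.faceFunctional_apply ha hr hx0
  have hlow : ∀ d, b.faceFunctional d ((edgesOf a).1 d) (edgesOf a) x = _ := fun d =>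
    hface d _ ⟨(ha d).1.le, (ha d).2.1.le.trans (ha d).2.2.le⟩
  have hupp : ∀ d, b.faceFunctional d ((edgesOf a).2 d) (edgesOf a) x = _ := fun d =>
    hface d _ ⟨(ha d).1.le.trans (ha d).2.1.le, (ha d).2.2.le⟩
  have hlf : ∀ d (c : Param), lowerForm d (edgesOf c) = c ((![0, 2, 4] : Fin 3 → Fin 7) d) :=
    fun _ _ => rfl
  have huf : ∀ d (c : Param), upperForm d (edgesOf c) = c ((![1, 3, 5] : Fin 3 → Fin 7) d) :=
    fun _ _ => rfl
  refine (congrArg (fun φ : Param →L[ℝ] ℝ => φ (EuclideanSpace.single j 1))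
    (hev.fderiv_eq.trans hd.fderiv)).trans ?_
  simp only [add_apply, smul_apply,
    ContinuousLinearMap.comp_apply, Fin.sum_univ_three, sub_apply,
    smul_eq_mul, hlf, huf, ← hlow, ← hupp]
  fin_cases j <;> simp [Box.edgeFunctional, Box.cuboidFunctional_apply, hg]

/-- Six of the seven columns carry a factor `P`. Vanishing of the determinant therefore depends on
the six edges alone, which is what leaves one dimension to spare against seven times. -/
theorem detF_eq_boxDet (hb : 0 < b.lo 2) (ω : Fin 7 → SDPair) {a : Param}
    (ha : edgesOf a ∈ b.innerEdges) {t : ℝ} (ht : 0 < t) :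
    detF m u ω t a = a 6 ^ 6 * boxDet m b u ω (b.edgeFunctional (edgesOf a), t) := by
  simp only [detF, boxDet, fderiv_measured m u hb ha _ ht]
  have := Matrix.det_mul_row (fun j : Fin 7 => if j = 6 then 1 else a 6)
    (Matrix.of fun i j => b.edgeFunctional (edgesOf a) j (boxKernel m b u (ω i) t))
  refine this.trans ?_
  congr 1
  simp [Fin.prod_univ_succ, Fin.ext_iff]
  ring

/-- Each entry is the bilinear pairing of a functional with an analytic curve, and the determinant
is a polynomial in the entries. -/
theorem analyticOnNhd_boxDet (hb : 0 < b.lo 2) (ω : Fin 7 → SDPair) :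
    AnalyticOnNhd ℝ (boxDet m b u ω) (Set.univ ×ˢ Set.Ioi 0) := by
  rintro ⟨L, t⟩ ⟨-, ht⟩
  have hentry : ∀ i j, AnalyticAt ℝ (fun z : (Fin 7 → Jet b.Carrier →L[ℝ] ℝ) × ℝ =>
      z.1 j (boxKernel m b u (ω i) z.2)) (L, t) :=
    fun i j => (analyticOnNhd_boxKernel m hb u (ω i) t ht).eval_pi L j
  have : boxDet m b u ω = fun z => ∑ σ : Equiv.Perm (Fin 7),
      ((Equiv.Perm.sign σ : ℤ) : ℝ) * ∏ i, z.1 i (boxKernel m b u (ω (σ i)) z.2) := by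
    funext z
    simp [boxDet, Matrix.det_apply']
  rw [this]
  exact Finset.analyticAt_fun_sum _ fun σ _ => analyticAt_const.mul
    (Finset.analyticAt_fun_prod _ fun i _ => hentry _ _)

end Determinant

end FDOT
end

/-! ### Density and openness of the complete time tuples. -/

noncomputable section

namespace FDOT

section DeterminantCondition

open Topology

theorem exists_box {a : Param} (ha : a ∈ admissible) :
    ∃ b : Box, 0 < b.lo 2 ∧ edgesOf a ∈ b.innerEdges := by
  obtain ⟨h0, h1, h2, h3, -⟩ := ha
  -- The lower height `a 4 / 2` keeps the box below the cuboid's bottom face yet off the boundary;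
  -- the other margins are arbitrary.
  refine ⟨⟨![a 0 - 1, a 2 - 1, a 4 / 2], ![a 1 + 1, a 3 + 1, a 5 + 1], fun i => ?_⟩, half_pos h2,
    fun d => ?_⟩
  · fin_cases i <;> simp <;> linarith
  · simp only [edgesOf_fst, edgesOf_snd]
    fin_cases d <;> simp <;> first | linarith | exact ⟨by linarith, by linarith⟩

theorem isOpen_admissible : IsOpen admissible := by
  have h : ∀ i, Continuous fun a : Param => a i := fun i => by fun_prop
  exact (isOpen_lt (h 0) (h 1)).inter ((isOpen_lt (h 2) (h 3)).inter
    ((isOpen_lt continuous_const (h 4)).inter ((isOpen_lt (h 4) (h 5)).inter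
      (isOpen_lt continuous_const (h 6)))))

attribute [local irreducible] detF boxDet

variable (m : Medium) (u : Measurement) (ω : Fin 7 → SDPair)

theorem continuousAt_detF {t : ℝ} (ht : 0 < t) {a : Param} (ha : a ∈ admissible) :
    ContinuousAt (fun z : ℝ × Param => detF m u ω z.1 z.2) (t, a) := by
  obtain ⟨b, hb, hab⟩ := exists_box ha
  obtain ⟨C, hC⟩ := b.exists_lipschitzOnWith_edgeFunctional
  have hN := (isOpen_innerEdges b).mem_nhds hab
  have hdet : ContinuousAt (boxDet m b u ω) (b.edgeFunctional (edgesOf a), t) :=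
    (analyticOnNhd_boxDet m u hb ω (_, t) ⟨trivial, ht⟩).continuousAt
  have hedge : ContinuousAt (fun z : ℝ × Param => b.edgeFunctional (edgesOf z.2)) (t, a) :=
    (hC.continuousOn.continuousAt hN).comp_of_eq
      (edgesOf.continuous.comp continuous_snd).continuousAt rfl
  have h6 : ContinuousAt (fun z : ℝ × Param => z.2 6 ^ 6) (t, a) :=
    Continuous.continuousAt (by fun_prop)
  have hprod := h6.mul (ContinuousAt.comp (g := boxDet m b u ω)
    (f := fun z : ℝ × Param => (b.edgeFunctional (edgesOf z.2), z.1)) (x := (t, a)) hdet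
    (hedge.prodMk continuousAt_fst))
  refine hprod.congr ?_
  have hsnd : ContinuousAt (fun z : ℝ × Param => edgesOf z.2) (t, a) :=
    (edgesOf.continuous.comp continuous_snd).continuousAt
  filter_upwards [continuousAt_fst.eventually (lt_mem_nhds ht), hsnd.eventually hN] with z hz1 hz2
  exact (detF_eq_boxDet m u hb ω hz2 hz1).symm

/-- The factorization of the determinant needs a box around the target. By second countability,
countably many boxes serve all of `A`, and on each the zero set theorem applies. The nonzero factor
`P ^ 6` is discarded. -/
theorem isCountablyLipschitzGraph_detF {A : Set Param} (hA : A ⊆ admissible) {t₀ : ℝ}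
    (ht₀ : 0 < t₀) (hdet : DetCondition m u ω t₀ A) :
    IsCountablyLipschitzGraph {z : Edges × ℝ | ∃ a ∈ A, edgesOf a = z.1 ∧ 0 < z.2 ∧
      detF m u ω z.2 a = 0} := by
  have : Nonempty Box := ⟨⟨0, 0, fun _ => le_rfl⟩⟩
  choose! b hb hab using fun (a : Param) (ha : a ∈ A) => exists_box (hA ha)
  obtain ⟨s, hsA, hs, hcov⟩ := TopologicalSpace.countable_cover_nhdsWithin
    (f := fun a => edgesOf ⁻¹' (b a).innerEdges) (s := A) fun a ha => mem_nhdsWithin_of_mem_nhds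
      (((isOpen_innerEdges (b a)).preimage edgesOf.continuous).mem_nhds (hab a ha))
  refine (IsCountablyLipschitzGraph.biUnion hs (Z := fun c => {z : Edges × ℝ |
    z.1 ∈ edgesOf '' (A ∩ edgesOf ⁻¹' (b c).innerEdges) ∧ z.2 ∈ Set.Ioi (0 : ℝ) ∧
      boxDet m (b c) u ω ((b c).edgeFunctional z.1, z.2) = 0}) fun c hc => ?_).mono ?_
  · obtain ⟨C, hC⟩ := (b c).exists_lipschitzOnWith_edgeFunctional
    refine isCountablyLipschitzGraph_zeros isOpen_Ioi isPreconnected_Ioi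
      (analyticOnNhd_boxDet m u (hb c (hsA hc)) ω) (hC.mono ?_) ht₀ ?_
    · rintro _ ⟨a, ha, rfl⟩
      exact ha.2
    · rintro _ ⟨a, ha, rfl⟩ h0
      refine hdet a ha.1 ?_
      rw [detF_eq_boxDet m u (hb c (hsA hc)) ω ha.2 ht₀, h0, mul_zero]
  · rintro ⟨p, t⟩ ⟨a, ha, rfl, ht, h0⟩
    obtain ⟨c, hc, hac⟩ := Set.mem_iUnion₂.1 (hcov ha)
    refine Set.mem_biUnion hc ⟨⟨a, ⟨ha, hac⟩, rfl⟩, ht, ?_⟩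
    rw [detF_eq_boxDet m u (hb c (hsA hc)) ω hac ht] at h0
    exact (mul_eq_zero.1 h0).resolve_left (pow_ne_zero _ (hA ha).2.2.2.2.ne')

theorem dense_setOf_detF_ne_zero {A : Set Param} (hA : A ⊆ admissible) {t₀ : ℝ} (ht₀ : 0 < t₀)
    (hdet : DetCondition m u ω t₀ A) :
    Dense {τ : Fin 7 → ℝ | ∀ a ∈ A, ∃ k, 0 < τ k → detF m u ω (τ k) a ≠ 0} := by
  refine (dense_setOf_forall_exists_notMem (isCountablyLipschitzGraph_detF m u ω hA ht₀ hdet)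
    ?_).mono fun τ hτ a ha => ?_
  -- The dimension count: `Edges` has dimension 6, and there are 7 times.
  · rw [Real.dimH_univ_eq_finrank]
    norm_num
  · obtain ⟨k, hk⟩ := hτ (edgesOf a)
    exact ⟨k, fun hpos h0 => hk ⟨a, ha, rfl, hpos, h0⟩⟩

variable {m u ω}

/-- `F`-completeness is a pointwise condition. -/
theorem fComplete_iff {A : Set Param} (hA : A ⊆ admissible) {n : ℕ} {t : Fin n → ℝ}
    (ht : ∀ k, 0 < t k) :
    FComplete m u ω t A ↔ ∀ a ∈ A, ∃ k, detF m u ω (t k) a ≠ 0 := by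
  constructor
  · rintro ⟨N, C, -, hcov, hC⟩ a ha
    rw [hcov] at ha
    obtain ⟨p, hp⟩ := Set.mem_iUnion.1 ha
    obtain ⟨k, hk⟩ := hC p
    exact ⟨k, abs_pos.1 (hk a hp)⟩
  · intro h
    refine ⟨n, fun k => A ∩ (admissible ∩ {a | detF m u ω (t k) a ≠ 0}), fun k => ⟨_, ?_, rfl⟩,
      ?_, fun k => ⟨k, fun a ha => abs_pos.2 ha.2.2⟩⟩
    · have hc : ContinuousOn (detF m u ω (t k)) admissible := fun a ha =>
        (ContinuousAt.comp (f := fun a : Param => (t k, a)) (x := a)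
          (g := fun z : ℝ × Param => detF m u ω z.1 z.2) (continuousAt_detF m u ω (ht k) ha)
          (Continuous.prodMk_right _).continuousAt).continuousWithinAt
      exact hc.isOpen_inter_preimage isOpen_admissible isOpen_ne
    · ext a
      simp only [Set.mem_iUnion, Set.mem_inter_iff]
      constructor
      · intro ha
        obtain ⟨k, hk⟩ := h a ha
        exact ⟨k, ha, hA ha, hk⟩
      · rintro ⟨k, ha, -⟩
        exact ha

/-- A nonzero determinant persists for nearby times and parameters; compactness of `K` makes the
neighbourhood of the time tuple uniform in the parameter. -/
theorem isOpen_completeTimes {T : Set ℝ} (hT : T ⊆ Set.Ioi 0) {K : Set Param} (hK : IsCompact K)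
    (hKA : K ⊆ admissible) : IsOpen (completeTimes m u ω T K) := by
  have heq : completeTimes m u ω T K = {t | ∀ a ∈ K, ∃ k, detF m u ω (t k) a ≠ 0} := by
    ext t
    exact fComplete_iff hKA fun k => hT (t k).2
  rw [heq, isOpen_iff_mem_nhds]
  intro t ht
  refine hK.eventually_forall_of_forall_eventually fun a ha => ?_
  obtain ⟨k, hk⟩ := ht a ha
  have hc : ContinuousAt (fun z : (Fin 7 → T) × Param => detF m u ω (z.1 k) z.2) (t, a) :=
    ContinuousAt.comp (f := fun z : (Fin 7 → T) × Param => ((z.1 k : ℝ), z.2)) (x := (t, a))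
      (g := fun z : ℝ × Param => detF m u ω z.1 z.2)
      (continuousAt_detF m u ω (hT (t k).2) (hKA ha)) (Continuous.continuousAt (by fun_prop))
  exact (hc.eventually_ne hk).mono fun z hz => ⟨k, hz⟩

theorem dense_completeTimes {T : Set ℝ} (hT : T.OrdConnected) (hTpos : T ⊆ Set.Ioi 0)
    {A : Set Param} (hA : A ⊆ admissible) {t₀ : ℝ} (ht₀ : t₀ ∈ T)
    (hdet : DetCondition m u ω t₀ A) : Dense (completeTimes m u ω T A) := by
  -- If `T` is the single point `t_*`, the only tuple is constant and the hypothesis applies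
  -- directly. Otherwise `T` lies in the closure of its interior, and a dense subset of `ℝ⁷` remains
  -- dense after intersection with the open set `(interior T)⁷`.
  rcases T.subsingleton_or_nontrivial with hsub | hnt
  · refine dense_iff_closure_eq.2 (Set.eq_univ_of_forall fun t => subset_closure ?_)
    refine (fComplete_iff hA fun k => hTpos (t k).2).2 fun a ha => ⟨0, ?_⟩
    rw [hsub (t 0).2 ht₀]
    exact hdet a ha
  have hint : (interior T).Nonempty := hT.convex.nontrivial_iff_nonempty_interior.1 hnt
  have hcl : T ⊆ closure (interior T) := by
    rw [hT.convex.closure_interior_eq_closure_of_nonempty_interior (𝕜 := ℝ) hint]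
    exact subset_closure
  let O : Set (Fin 7 → ℝ) := Set.pi Set.univ fun _ => interior T
  have hO : IsOpen O := isOpen_set_pi Set.finite_univ fun _ _ => isOpen_interior
  have hD := dense_setOf_detF_ne_zero m u ω hA (hTpos ht₀) hdet
  have hind : IsInducing fun (t : Fin 7 → T) k => (t k : ℝ) :=
    IsInducing.piMap fun _ => IsInducing.subtypeVal
  intro t
  rw [hind.closure_eq_preimage_closure_image, Set.mem_preimage]
  have hmem : (fun k => (t k : ℝ)) ∈ closure O := by
    rw [closure_pi_set]
    exact fun k _ => hcl (t k).2
  refine closure_mono ?_ (closure_minimal (hD.open_subset_closure_inter hO) isClosed_closure hmem)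
  rintro τ ⟨hτO, hτ⟩
  have hτT : ∀ k, τ k ∈ T := fun k => interior_subset (hτO k trivial)
  refine ⟨fun k => ⟨τ k, hτT k⟩, (fComplete_iff hA fun k => hTpos (hτT k)).2 fun a ha => ?_, rfl⟩
  obtain ⟨k, hk⟩ := hτ a ha
  exact ⟨k, hk (hTpos (hτT k))⟩

end DeterminantCondition

end FDOT
end

theorem mainTheorem8 (m : FDOT.Medium) (u : FDOT.Measurement) (ω : Fin 7 → FDOT.SDPair)
    (T : Set ℝ) (hT : T.OrdConnected) (hTpos : T ⊆ Set.Ioi 0)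
    (a₀ : FDOT.Param) (r : ℝ) (hr : 0 < r) (hB : Metric.ball a₀ r ⊆ FDOT.admissible)
    (tstar : ℝ) (htstar : tstar ∈ T)
    (hdet : FDOT.DetCondition m u ω tstar (Metric.ball a₀ r)) :
    Dense (FDOT.completeTimes m u ω T (Metric.ball a₀ r)) ∧
    (∀ K : Set FDOT.Param, IsCompact K → K ⊆ Metric.ball a₀ r →
      IsOpen (FDOT.completeTimes m u ω T K) ∧ Dense (FDOT.completeTimes m u ω T K)) ∧
    (Metric.closedBall a₀ r ⊆ FDOT.admissible →
      FDOT.DetCondition m u ω tstar (Metric.closedBall a₀ r) →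
      IsOpen (FDOT.completeTimes m u ω T (Metric.closedBall a₀ r)) ∧
      Dense (FDOT.completeTimes m u ω T (Metric.closedBall a₀ r))) :=
  ⟨FDOT.dense_completeTimes hT hTpos hB htstar hdet,
    fun _ hK hKB => ⟨FDOT.isOpen_completeTimes hTpos hK (hKB.trans hB),
      FDOT.dense_completeTimes hT hTpos (hKB.trans hB) htstar fun a ha => hdet a (hKB ha)⟩,
    fun hC hdetC => ⟨FDOT.isOpen_completeTimes hTpos (isCompact_closedBall a₀ r) hC,
      FDOT.dense_completeTimes hT hTpos hC htstar hdetC⟩⟩
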